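/- Let $G$ be a finite simple plane graph (vertices are points of the plane, edges are arcs joining their ends, and the interior of an edge contains no vertex and no point of any other edge) that is triangulated, in the sense that the boundary of every internal (that is, bounded) face is a cycle of length $3$ of $G$; nothing is required of the outer face. Identify each internal face with the edge set of its boundary cycle, and let $\alpha$ and $\beta$ be two distinct internal faces of $G$ with an edge in common. Let $C$ be the set of internal faces of $G$ with $\alpha$ replaced by $\alpha \,\Delta\, \beta$. Then $C$ is a set of cycles of $G$ that cyclically spans the cycle space of $G$: for each cycle $\sigma$ of $G$ there are $m\ge 1$ and cycles $\alpha_1,\dots,\alpha_m\in C$ such that $\sigma=\alpha_1\,\Delta\,\alpha_2\,\Delta\cdots\Delta\,\alpha_m$ and, for $i=2,\dots,m$, $\alpha_1\,\Delta\cdots\Delta\,\alpha_i$ is a cycle of $G$ (cycles are regarded as edge sets and $\Delta$ is symmetric difference). -/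

import Mathlib

open scoped symmDiff

/-- A plane graph: a simple graph on `V` drawn in the Euclidean plane, here `ℂ`. Vertices are
distinct points, every edge is an arc (a homeomorphic image of `[0, 1]`) between its two ends, and
the interior of an edge contains no vertex and no point of any other edge.
Only the values of `arc` at edges of the graph matter. -/
structure PlaneGraph (V : Type*) where
  /-- the underlying abstract graph -/
  graph : SimpleGraph V
  /-- the position of a vertex -/
  point : V → ℂ
  /-- the point set of an edge, ends included -/
  arc : Sym2 V → Set ℂ
  point_injective : Function.Injective point
  isArc : ∀ u v : V, graph.Adj u v →
    ∃ p : Path (point u) (point v), Function.Injective p ∧ arc s(u, v) = Set.range p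
  mem_of_point_mem_arc : ∀ e ∈ graph.edgeSet, ∀ w : V, point w ∈ arc e → w ∈ e
  common_end_of_mem_arcs : ∀ e ∈ graph.edgeSet, ∀ f ∈ graph.edgeSet, e ≠ f →
    ∀ z : ℂ, z ∈ arc e → z ∈ arc f → ∃ w : V, w ∈ e ∧ w ∈ f ∧ point w = z

/-- `σ` is the edge set of a cycle of the graph `H`. -/
def IsCycleEdgeSet {V : Type*} (H : SimpleGraph V) (σ : Set (Sym2 V)) : Prop :=
  ∃ (u : V) (p : H.Walk u u), p.IsCycle ∧ σ = {e | e ∈ p.edges}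

/-- `α₁ ∆ α₂ ∆ ⋯ ∆ αᵢ` for a sequence of edge sets indexed from `1`. -/
def partialSymmDiff {V : Type*} (α : ℕ → Set (Sym2 V)) : ℕ → Set (Sym2 V)
  | 0 => ∅
  | i + 1 => partialSymmDiff α i ∆ α (i + 1)

/-- `C` is a set of cycles of `H` that cyclically spans the cycle space of `H`: every cycle `σ` is
`α₁ ∆ ⋯ ∆ αₘ` for cycles `α₁, …, αₘ` in `C` such that `α₁ ∆ ⋯ ∆ αᵢ` is a cycle of `H` for
`i = 2, …, m`. -/
def CyclicallySpans {V : Type*} (H : SimpleGraph V) (C : Set (Set (Sym2 V))) : Prop :=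
  (∀ γ ∈ C, IsCycleEdgeSet H γ) ∧
  ∀ σ : Set (Sym2 V), IsCycleEdgeSet H σ →
    ∃ (m : ℕ) (α : ℕ → Set (Sym2 V)), 1 ≤ m ∧
      (∀ i, 1 ≤ i → i ≤ m → α i ∈ C) ∧
      σ = partialSymmDiff α m ∧
      ∀ i, 2 ≤ i → i ≤ m → IsCycleEdgeSet H (partialSymmDiff α i)

namespace PlaneGraph

/-- The part of the plane covered by a set of edges. -/
def drawing {V : Type*} (G : PlaneGraph V) (C : Set (Sym2 V)) : Set ℂ :=
  ⋃ e ∈ C, G.arc e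

/-- The part of the plane covered by all vertices and edges. -/
def support {V : Type*} (G : PlaneGraph V) : Set ℂ :=
  Set.range G.point ∪ G.drawing G.graph.edgeSet

/-- Faces are the connected components of the complement of the drawing. -/
def IsFace {V : Type*} (G : PlaneGraph V) (F : Set ℂ) : Prop :=
  ∃ z ∈ G.supportᶜ, F = connectedComponentIn G.supportᶜ z

/-- Internal faces are the bounded ones. -/
def IsInternalFace {V : Type*} (G : PlaneGraph V) (F : Set ℂ) : Prop :=
  G.IsFace F ∧ Bornology.IsBounded F

/-- The set of edges of a face: those edges that lie in its topological boundary. -/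
def faceEdges {V : Type*} (G : PlaneGraph V) (F : Set ℂ) : Set (Sym2 V) :=
  {e | e ∈ G.graph.edgeSet ∧ G.arc e ⊆ frontier F}

/-- The topological boundary of `F` is the drawing of a cycle of length `3`. -/
def IsBoundedByTriangle {V : Type*} (G : PlaneGraph V) (F : Set ℂ) : Prop :=
  ∃ C : Set (Sym2 V), IsCycleEdgeSet G.graph C ∧ C.ncard = 3 ∧ frontier F = G.drawing C

/-- Every internal face is bounded by a triangle. Nothing is required of the outer face, so plane
graphs with all faces triangles and those with only the internal faces triangles are covered. -/
def IsTriangulated {V : Type*} (G : PlaneGraph V) : Prop :=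
  ∀ F : Set ℂ, G.IsInternalFace F → G.IsBoundedByTriangle F

/-- The internal faces, viewed as sets of edges. -/
def internalFaceCycles {V : Type*} (G : PlaneGraph V) : Set (Set (Sym2 V)) :=
  {γ | ∃ F : Set ℂ, G.IsInternalFace F ∧ γ = G.faceEdges F}

end PlaneGraph

/-! The idea is to build a cycle by adding the faces inside it one at a time, never adding `A`
except possibly as the very first face. Every cycle is the boundary (sum modulo 2) of the internal
faces inside it, and different sets of internal faces have different boundaries. Since cycles are
exactly the minimal nonempty even edge sets, cycles correspond to the sets of faces with minimal
boundary, the bonds. In the dual graph with the outer face added, these are the sets that are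
connected together with their complement.

The combinatorial core is `IsFaceBond.exists_erase`: from a bond with at least two faces, a face
other than a prescribed one can be removed so that a bond remains. It rests on counting: each face
has three edges, while the boundary of every nonempty set of faces has at least three, because it is
even and the graph is simple. Removing faces while protecting `A`, and reading the removals
backwards, writes a cycle as a sum of faces all of whose partial sums are cycles, with `A` first if
it occurs at all. The face `A` itself is replaced by the two steps `A ∆ B` and `B`.

The topological input is that a cycle has an inside and that exactly two faces meet along each edge
of a cycle. It is proved by continuous logarithms: `(z - a) / (z - b)` has a continuous logarithm on
a compact set exactly when the set does not separate `a` from `b`. Gluing logarithms along an arc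
shows that the arc creates at most one new component, and that it does create one if its ends are
already joined in the rest. -/

/-! ### Bonds of faces: an abstract incidence structure of faces and edges. -/

section FaceSets

variable {Φ E : Type*}

/-- The boundary of a finite set of faces: the edges on exactly one face of the set. -/
def faceBoundary (inc : Φ → Set E) (S : Finset Φ) : Set E :=
  {e | ∃ F ∈ S, e ∈ inc F ∧ ∀ F' ∈ S, e ∈ inc F' → F' = F}

/-- A nonempty set of faces whose boundary is minimal among the boundaries of sets of faces. -/
def IsFaceBond (inc : Φ → Set E) (S : Finset Φ) : Prop :=
  S.Nonempty ∧ ∀ R : Finset Φ, faceBoundary inc R ⊆ faceBoundary inc S → R = ∅ ∨ R = S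

/-- Every edge is on at most two faces. -/
def AtMostTwoFaces (inc : Φ → Set E) : Prop :=
  ∀ e F₁ F₂ F₃, e ∈ inc F₁ → e ∈ inc F₂ → e ∈ inc F₃ → F₁ = F₂ ∨ F₁ = F₃ ∨ F₂ = F₃

/-- `X` cannot be split into two nonempty parts without a common edge. -/
def IsFaceConnected (inc : Φ → Set E) (A : Φ) (X : Finset Φ) : Prop :=
  A ∈ X ∧ ∀ R ⊆ X, A ∈ R → (∀ F ∈ R, ∀ F' ∈ X, F' ∉ R → Disjoint (inc F) (inc F')) → R = X

variable {inc : Φ → Set E}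

lemma faceBoundary_empty (inc : Φ → Set E) : faceBoundary inc ∅ = ∅ := by
  ext e
  simp [faceBoundary]

lemma faceBoundary_singleton (inc : Φ → Set E) (F : Φ) :
    faceBoundary inc {F} = inc F := by
  ext e
  simp [faceBoundary]

lemma isFaceConnected_singleton (A : Φ) : IsFaceConnected inc A {A} := by
  refine ⟨Finset.mem_singleton_self A, fun R hR hA _ => ?_⟩
  exact Finset.Subset.antisymm hR (Finset.singleton_subset_iff.2 hA)

lemma IsFaceConnected.insert [DecidableEq Φ] {A y : Φ} {X : Finset Φ}
    (h : IsFaceConnected inc A X) {F : Φ} (hF : F ∈ X)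
    (hyF : ¬ Disjoint (inc F) (inc y)) : IsFaceConnected inc A (insert y X) := by
  refine ⟨Finset.mem_insert_of_mem h.1, fun R hR hA hsep => ?_⟩
  have h1 : R ∩ X = X := by
    refine h.2 _ Finset.inter_subset_right (Finset.mem_inter.2 ⟨hA, h.1⟩) fun G hG G' hG' hGR => ?_
    refine hsep G (Finset.mem_inter.1 hG).1 G' (Finset.mem_insert_of_mem hG') fun h' => hGR ?_
    exact Finset.mem_inter.2 ⟨h', hG'⟩
  have h2 : X ⊆ R := Finset.inter_eq_right.1 h1
  have h3 : y ∈ R := by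
    by_contra hyR
    exact hyF (hsep F (h2 hF) y (Finset.mem_insert_self y X) hyR)
  exact Finset.Subset.antisymm hR (Finset.insert_subset h3 h2)

lemma exists_other_face_of_notMem_faceBoundary {S : Finset Φ} {F : Φ} {e : E} (hF : F ∈ S)
    (he : e ∈ inc F) (hS : e ∉ faceBoundary inc S) : ∃ F' ∈ S, e ∈ inc F' ∧ F' ≠ F := by
  by_contra! h
  exact hS ⟨F, hF, he, h⟩

lemma faceBoundary_eq_symmDiff_erase [DecidableEq Φ] (h2 : AtMostTwoFaces inc) {S : Finset Φ}
    {T : Φ} (hT : T ∈ S) :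
    faceBoundary inc S = faceBoundary inc (S.erase T) ∆ inc T := by
  ext e
  simp only [Set.mem_symmDiff]
  constructor
  · rintro ⟨F, hF, he, hu⟩
    by_cases heT : e ∈ inc T
    · refine Or.inr ⟨heT, ?_⟩
      rintro ⟨F', hF', he', -⟩
      rw [Finset.mem_erase] at hF'
      exact hF'.1 ((hu F' hF'.2 he').trans (hu T hT heT).symm)
    · refine Or.inl ⟨⟨F, Finset.mem_erase.2 ⟨?_, hF⟩, he, ?_⟩, heT⟩
      · rintro rfl; exact heT he
      · exact fun F' hF' => hu F' (Finset.mem_erase.1 hF').2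
  · rintro (⟨⟨F, hF, he, hu⟩, heT⟩ | ⟨heT, hn⟩)
    · refine ⟨F, (Finset.mem_erase.1 hF).2, he, fun F' hF' he' => hu F' ?_ he'⟩
      refine Finset.mem_erase.2 ⟨?_, hF'⟩
      rintro rfl; exact heT he'
    · refine ⟨T, hT, heT, fun F' hF' he' => ?_⟩
      by_contra hne
      have hF'' : F' ∈ S.erase T := Finset.mem_erase.2 ⟨hne, hF'⟩
      obtain ⟨G, hG, heG, hGF⟩ := exists_other_face_of_notMem_faceBoundary hF'' he' hn
      rcases h2 e T F' G heT he' heG with h | h | h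
      · exact hne h.symm
      · exact (Finset.mem_erase.1 hG).1 h.symm
      · exact hGF h.symm

/-- In the dual graph with an outer face, `e₀` joins `T` to the outer face. Hence moving `T` out of
`S` keeps the complement connected, and the remaining part `X` is connected by assumption. -/
lemma IsFaceBond.erase [DecidableEq Φ] (h2 : AtMostTwoFaces inc) {S X : Finset Φ} {A T : Φ}
    (hS : IsFaceBond inc S) (hT : T ∉ X) (hSX : S = insert T X) (hX : IsFaceConnected inc A X)
    {e₀ : E} (he₀T : e₀ ∈ inc T) (he₀S : e₀ ∈ faceBoundary inc S) : IsFaceBond inc X := by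
  have hXS : X ⊆ S := hSX ▸ Finset.subset_insert T X
  have hTS : T ∈ S := hSX ▸ Finset.mem_insert_self T X
  -- The complement of `X` is connected to the outer face. Without `T`, such an `R` lies outside `S`
  -- and has its boundary inside that of `S`, so nothing is left; and `R = {T}` is impossible since
  -- `e₀` is on no face of `X`.
  have key : ∀ R : Finset Φ, Disjoint R X → faceBoundary inc R ⊆ faceBoundary inc X → R = ∅ := by
    intro R hRX hbd
    have hR0 : R.erase T = ∅ := by
      have hdisj : ∀ F ∈ R.erase T, F ∉ S := by
        intro F hF hFS
        rw [Finset.mem_erase] at hF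
        rw [hSX, Finset.mem_insert] at hFS
        exact hFS.elim hF.1 (Finset.disjoint_left.1 hRX hF.2)
      have hsub : faceBoundary inc (R.erase T) ⊆ faceBoundary inc S := by
        rintro e ⟨F, hF, he, hu⟩
        have hex : ∃ F' ∈ S, e ∈ inc F' := by
          by_contra! hno
          have : e ∈ faceBoundary inc R := by
            refine ⟨F, (Finset.mem_erase.1 hF).2, he, fun F' hF' he' => hu F' ?_ he'⟩
            refine Finset.mem_erase.2 ⟨?_, hF'⟩
            rintro rfl; exact hno _ hTS he'
          obtain ⟨G, hG, heG, -⟩ := hbd this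
          exact hno G (hXS hG) heG
        obtain ⟨F', hF', he'⟩ := hex
        refine ⟨F', hF', he', fun G hG heG => ?_⟩
        rcases h2 e F F' G he he' heG with h | h | h
        · exact absurd (h ▸ hF') (hdisj F hF)
        · exact absurd (h ▸ hG) (hdisj F hF)
        · exact h.symm
      rcases hS.2 _ hsub with h | h
      · exact h
      · exact absurd hTS (hdisj T (h ▸ hTS))
    by_contra hne
    obtain ⟨F, hF⟩ := Finset.nonempty_iff_ne_empty.2 hne
    have hR : ∀ G ∈ R, G = T := by
      intro G hG
      by_contra hGT
      exact Finset.notMem_empty G (hR0 ▸ Finset.mem_erase.2 ⟨hGT, hG⟩)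
    have hTR : T ∈ R := hR F hF ▸ hF
    obtain ⟨G, hG, heG, -⟩ := hbd ⟨T, hTR, he₀T, fun G hG _ => hR G hG⟩
    obtain ⟨G', -, -, hu⟩ := he₀S
    exact hT ((hu T hTS he₀T).trans (hu G (hXS hG) heG).symm ▸ hG)
  refine ⟨⟨A, hX.1⟩, fun R hbd => ?_⟩
  -- An edge between a face of `X` in `R` and a face of `X` outside `R` would be in the boundary of
  -- `R` but not in that of `X`. So the connected set `X` lies inside `R` or is disjoint from it.
  have hsep : ∀ F ∈ X, F ∈ R → ∀ F' ∈ X, F' ∉ R → Disjoint (inc F) (inc F') := by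
    intro F hFX hFR F' hF'X hF'R
    rw [Set.disjoint_left]
    intro e he he'
    have hne : F' ≠ F := by rintro rfl; exact hF'R hFR
    by_cases heR : e ∈ faceBoundary inc R
    · obtain ⟨G, -, -, hu⟩ := hbd heR
      exact hne ((hu F' hF'X he').trans (hu F hFX he).symm)
    · obtain ⟨G, hG, heG, hGF⟩ := exists_other_face_of_notMem_faceBoundary hFR he heR
      rcases h2 e F F' G he he' heG with h | h | h
      · exact hne h.symm
      · exact hGF h.symm
      · exact hF'R (h ▸ hG)
  by_cases hA : A ∈ R
  · have h1 : R ∩ X = X := by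
      refine hX.2 _ Finset.inter_subset_right (Finset.mem_inter.2 ⟨hA, hX.1⟩) ?_
      intro F hF F' hF' hF'R
      rw [Finset.mem_inter] at hF
      exact hsep F hF.2 hF.1 F' hF' fun h => hF'R (Finset.mem_inter.2 ⟨h, hF'⟩)
    have h1' : X ⊆ R := Finset.inter_eq_right.1 h1
    right
    have h3 : R \ X = ∅ := by
      refine key _ Finset.sdiff_disjoint ?_
      rintro e ⟨F, hF, he, hu⟩
      rw [Finset.mem_sdiff] at hF
      by_cases hex : ∃ F' ∈ X, e ∈ inc F'
      · obtain ⟨F', hF', he'⟩ := hex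
        refine ⟨F', hF', he', fun G hG heG => ?_⟩
        rcases h2 e F F' G he he' heG with h | h | h
        · exact absurd (h ▸ hF') hF.2
        · exact absurd (h ▸ hG) hF.2
        · exact h.symm
      · push Not at hex
        refine hbd ⟨F, hF.1, he, fun G hG heG => hu G ?_ heG⟩
        exact Finset.mem_sdiff.2 ⟨hG, fun h => hex G h heG⟩
    exact Finset.Subset.antisymm (Finset.sdiff_eq_empty_iff_subset.1 h3) h1'
  · left
    have h1 : X \ R = X := by
      refine hX.2 _ Finset.sdiff_subset (Finset.mem_sdiff.2 ⟨hX.1, hA⟩) ?_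
      intro F hF F' hF' hF'R
      rw [Finset.mem_sdiff] at hF
      have : F' ∈ R := by
        by_contra h
        exact hF'R (Finset.mem_sdiff.2 ⟨hF', h⟩)
      exact (hsep F' hF' this F hF.1 hF.2).symm
    exact key R (Finset.sdiff_eq_self_iff_disjoint.1 h1).symm hbd

/-- If only `A` met the boundary of `S`, then this boundary would consist of all three edges of `A`,
and the other faces of `S` would have empty boundary. -/
lemma IsFaceBond.exists_ne_face_meeting_boundary [DecidableEq Φ] [Finite E]
    (h2 : AtMostTwoFaces inc) (h3 : ∀ F, (inc F).ncard = 3)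
    (hlarge : ∀ S : Finset Φ, S.Nonempty → 3 ≤ (faceBoundary inc S).ncard)
    {S : Finset Φ} {A : Φ} (hA : A ∈ S) (hcard : 2 ≤ S.card) :
    ∃ T ∈ S, T ≠ A ∧ ∃ e ∈ inc T, e ∈ faceBoundary inc S := by
  by_contra! hno
  have hsub : faceBoundary inc S ⊆ inc A := by
    rintro e ⟨F, hF, he, hu⟩
    by_cases hFA : F = A
    · exact hFA ▸ he
    · exact absurd ⟨F, hF, he, hu⟩ (hno F hF hFA e he)
  have heq : faceBoundary inc S = inc A :=
    Set.eq_of_subset_of_ncard_le hsub (by rw [h3]; exact hlarge S ⟨A, hA⟩) (Set.toFinite _)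
  have hne : (S.erase A).Nonempty := by
    rw [← Finset.card_pos, Finset.card_erase_of_mem hA]; omega
  have h := faceBoundary_eq_symmDiff_erase h2 hA
  rw [heq] at h
  have hemp : faceBoundary inc (S.erase A) = ∅ := by
    rw [← Set.bot_eq_empty]
    exact symmDiff_eq_right.1 h.symm
  have := hlarge _ hne
  rw [hemp, Set.ncard_empty] at this
  omega

/-- One face different from `A` can be removed from a bond such that a bond remains. -/
theorem IsFaceBond.exists_erase [DecidableEq Φ] [Finite E]
    (h2 : AtMostTwoFaces inc) (h3 : ∀ F, (inc F).ncard = 3)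
    (hlarge : ∀ S : Finset Φ, S.Nonempty → 3 ≤ (faceBoundary inc S).ncard)
    {S : Finset Φ} {A : Φ} (hS : IsFaceBond inc S) (hA : A ∈ S) (hcard : 2 ≤ S.card) :
    ∃ T ∈ S, T ≠ A ∧ IsFaceBond inc (S.erase T) := by
  classical
  -- A largest connected `X` containing `A` is taken among those that leave out some face `T` on the
  -- boundary of `S`. It turns out that `T` is the only face left out, so `T` can be removed.
  let P : Finset Φ → Prop := fun X => X ⊆ S ∧ IsFaceConnected inc A X ∧
    ∃ T ∈ S, T ∉ X ∧ ∃ e ∈ inc T, e ∈ faceBoundary inc S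
  have hP : ∃ X, P X := by
    obtain ⟨T, hT, hTA, he⟩ :=
      IsFaceBond.exists_ne_face_meeting_boundary h2 h3 hlarge hA hcard
    exact ⟨{A}, Finset.singleton_subset_iff.2 hA, isFaceConnected_singleton A, T, hT,
      by simpa using hTA, he⟩
  obtain ⟨X, hXP, hmax⟩ : ∃ X, P X ∧ ∀ Y, P Y → Y.card ≤ X.card := by
    obtain ⟨X, hX, hmax⟩ := Finset.exists_max_image (S.powerset.filter P) Finset.card (by
      obtain ⟨X, hX⟩ := hP
      exact ⟨X, Finset.mem_filter.2 ⟨Finset.mem_powerset.2 hX.1, hX⟩⟩)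
    refine ⟨X, (Finset.mem_filter.1 hX).2, fun Y hY => hmax Y ?_⟩
    exact Finset.mem_filter.2 ⟨Finset.mem_powerset.2 hY.1, hY⟩
  obtain ⟨hXS, hX, T, hTS, hTX, e₀, he₀T, he₀S⟩ := hXP
  have hgrow : ∀ y, y ∉ X → ¬ P (insert y X) := by
    intro y hy hPy
    have := hmax _ hPy
    rw [Finset.card_insert_of_notMem hy] at this
    omega
  have hXT : S = insert T X := by
    by_contra hne
    obtain ⟨y₀, hy₀S, hy₀⟩ : ∃ y ∈ S, y ∉ insert T X := by
      by_contra! h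
      exact hne (Finset.Subset.antisymm h (Finset.insert_subset hTS hXS))
    -- A further face `y` touching `X` could be added to `X` while `T` still stays outside, against
    -- maximality.
    have hXY : ∀ y ∈ S, y ∉ insert T X → ∀ F ∈ X, Disjoint (inc F) (inc y) := by
      intro y hyS hy F hF
      rw [Finset.mem_insert, not_or] at hy
      by_contra hd
      refine hgrow y hy.2 ⟨Finset.insert_subset hyS hXS, hX.insert hF hd, T, hTS, ?_, e₀,
        he₀T, he₀S⟩
      rw [Finset.mem_insert, not_or]
      exact ⟨fun h => hy.1 h.symm, hTX⟩
    have hTadj : ∃ F ∈ X, ¬ Disjoint (inc F) (inc T) := by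
      by_contra! hno
      have : faceBoundary inc X ⊆ faceBoundary inc S := by
        rintro e ⟨F, hF, he, hu⟩
        refine ⟨F, hXS hF, he, fun G hG heG => ?_⟩
        by_cases hGX : G ∈ X
        · exact hu G hGX heG
        · by_cases hGT : G = T
          · subst hGT
            exact absurd heG (Set.disjoint_left.1 (hno F hF) he)
          · exact absurd heG
              (Set.disjoint_left.1 (hXY G hG (by simp [hGT, hGX]) F hF) he)
      rcases hS.2 X this with h | h
      · rw [h] at hX; exact Finset.notMem_empty _ hX.1
      · exact hTX (h ▸ hTS)
    let Y := S.filter fun y => y ∉ insert T X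
    have hYne : Y.Nonempty := ⟨y₀, Finset.mem_filter.2 ⟨hy₀S, hy₀⟩⟩
    -- Otherwise each boundary edge of `Y` is shared with `T`, the only other face that `Y` can
    -- touch. As `e₀` is not among them, at most two edges remain, fewer than three. The face `T'`
    -- found here takes over the role of `T`, so that `T` can be added to `X`.
    have hex : ∃ T' ∈ Y, ∃ e ∈ inc T', e ∈ faceBoundary inc S := by
      by_contra! hno
      have hsub : faceBoundary inc Y ⊆ inc T \ {e₀} := by
        rintro e ⟨F, hF, he, hu⟩
        have hFS := (Finset.mem_filter.1 hF).1
        have hF' := (Finset.mem_filter.1 hF).2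
        obtain ⟨G, hG, heG, hGF⟩ := exists_other_face_of_notMem_faceBoundary hFS he (hno F hF e he)
        have hGT : G = T := by
          by_contra hGT
          by_cases hGX : G ∈ X
          · exact Set.disjoint_left.1 (hXY F hFS hF' G hGX) heG he
          · exact hGF (hu G (Finset.mem_filter.2 ⟨hG, by simp [hGT, hGX]⟩) heG)
        refine ⟨hGT ▸ heG, ?_⟩
        rintro rfl
        exact hno F hF e he he₀S
      have h4 := Set.ncard_le_ncard hsub (Set.toFinite _)
      rw [Set.ncard_sdiff_singleton_of_mem he₀T, h3] at h4
      have := hlarge Y hYne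
      omega
    obtain ⟨T', hT'Y, e', he', he'S⟩ := hex
    obtain ⟨F, hF, hFT⟩ := hTadj
    exact hgrow T hTX ⟨Finset.insert_subset hTS hXS, hX.insert hF hFT, T',
      (Finset.mem_filter.1 hT'Y).1, (Finset.mem_filter.1 hT'Y).2, e', he', he'S⟩
  refine ⟨T, hTS, fun h => hTX (h ▸ hX.1), ?_⟩
  have : S.erase T = X := by rw [hXT, Finset.erase_insert hTX]
  rw [this]
  exact hS.erase h2 hTX hXT hX he₀T he₀S

end FaceSets

/-! ### Even edge sets and cycles. -/

section EvenEdgeSets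

variable {V : Type*}

/-- The edge `e` has one end inside `W` and one end outside `W`. -/
def EdgeCrosses (W : Set V) (e : Sym2 V) : Prop :=
  ∃ a ∈ W, ∃ b, b ∉ W ∧ e = s(a, b)

lemma edgeCrosses_mk {W : Set V} {a b : V} :
    EdgeCrosses W s(a, b) ↔ (a ∈ W ∧ b ∉ W) ∨ (b ∈ W ∧ a ∉ W) := by
  constructor
  · rintro ⟨c, hc, d, hd, h⟩
    rcases Sym2.eq_iff.1 h with ⟨rfl, rfl⟩ | ⟨rfl, rfl⟩
    · exact Or.inl ⟨hc, hd⟩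
    · exact Or.inr ⟨hc, hd⟩
  · rintro (⟨h1, h2⟩ | ⟨h1, h2⟩)
    · exact ⟨a, h1, b, h2, rfl⟩
    · exact ⟨b, h1, a, h2, Sym2.eq_swap⟩

/-- A set of edges that meets every cut in an even number of edges. -/
def IsEvenEdgeSet (D : Set (Sym2 V)) : Prop :=
  ∀ W : Set V, Even {e | e ∈ D ∧ EdgeCrosses W e}.ncard

lemma ncard_symmDiff_add {α : Type*} [Finite α] (A B : Set α) :
    (A ∆ B).ncard + 2 * (A ∩ B).ncard = A.ncard + B.ncard := by
  have h1 := Set.ncard_inter_add_ncard_sdiff_eq_ncard A B (Set.toFinite _)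
  have h2 := Set.ncard_inter_add_ncard_sdiff_eq_ncard B A (Set.toFinite _)
  have h3 : (A ∆ B).ncard = (A \ B).ncard + (B \ A).ncard :=
    Set.ncard_union_eq disjoint_sdiff_sdiff (Set.toFinite _) (Set.toFinite _)
  rw [Set.inter_comm] at h2
  omega

lemma IsEvenEdgeSet.symmDiff [Finite V] {D D' : Set (Sym2 V)} (h : IsEvenEdgeSet D)
    (h' : IsEvenEdgeSet D') : IsEvenEdgeSet (D ∆ D') := by
  intro W
  have heq : {e | e ∈ D ∆ D' ∧ EdgeCrosses W e} =
      {e | e ∈ D ∧ EdgeCrosses W e} ∆ {e | e ∈ D' ∧ EdgeCrosses W e} := by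
    ext e
    simp only [Set.mem_symmDiff, Set.mem_ofPred_eq]
    tauto
  have h1 := ncard_symmDiff_add {e | e ∈ D ∧ EdgeCrosses W e} {e | e ∈ D' ∧ EdgeCrosses W e}
  have h2 := h W
  have h3 := h' W
  rw [heq]
  rw [Nat.even_iff] at *
  omega

lemma isEvenEdgeSet_empty : IsEvenEdgeSet (∅ : Set (Sym2 V)) := by
  intro W
  simp

/-- Each crossing edge changes the side of `W`, and a trail uses every edge once, so counting the
set of edges counts the changes. -/
lemma SimpleGraph.Walk.IsTrail.odd_ncard_crossing_iff [Finite V] {H : SimpleGraph V} (W : Set V)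
    {u v : V} {p : H.Walk u v} (hp : p.IsTrail) :
    Odd {e | e ∈ p.edges ∧ EdgeCrosses W e}.ncard ↔ ¬(u ∈ W ↔ v ∈ W) := by
  induction p with
  | nil => simp
  | @cons u x v h q ih =>
    rw [SimpleGraph.Walk.isTrail_cons] at hp
    have ih := ih hp.1
    by_cases hc : EdgeCrosses W s(u, x)
    · have heq : {e | e ∈ (SimpleGraph.Walk.cons h q).edges ∧ EdgeCrosses W e} =
          insert s(u, x) {e | e ∈ q.edges ∧ EdgeCrosses W e} := by
        ext e
        simp only [SimpleGraph.Walk.edges_cons, List.mem_cons, Set.mem_ofPred_eq, Set.mem_insert_iff]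
        constructor
        · rintro ⟨rfl | h, h'⟩
          · exact Or.inl rfl
          · exact Or.inr ⟨h, h'⟩
        · rintro (rfl | h)
          · exact ⟨Or.inl rfl, hc⟩
          · exact ⟨Or.inr h.1, h.2⟩
      rw [heq, Set.ncard_insert_of_notMem (fun h => hp.2 h.1) (Set.toFinite _), Nat.odd_add_one, ih]
      rw [edgeCrosses_mk] at hc
      tauto
    · have heq : {e | e ∈ (SimpleGraph.Walk.cons h q).edges ∧ EdgeCrosses W e} =
          {e | e ∈ q.edges ∧ EdgeCrosses W e} := by
        ext e
        simp only [SimpleGraph.Walk.edges_cons, List.mem_cons, Set.mem_ofPred_eq]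
        constructor
        · rintro ⟨rfl | h, h'⟩
          · exact absurd h' hc
          · exact ⟨h, h'⟩
        · exact fun h => ⟨Or.inr h.1, h.2⟩
      rw [heq, ih]
      rw [edgeCrosses_mk] at hc
      tauto

variable {H : SimpleGraph V} {σ : Set (Sym2 V)}

lemma IsCycleEdgeSet.isEvenEdgeSet [Finite V] (h : IsCycleEdgeSet H σ) : IsEvenEdgeSet σ := by
  obtain ⟨u, p, hp, rfl⟩ := h
  intro W
  have := hp.isTrail.odd_ncard_crossing_iff W
  rw [← Nat.not_odd_iff_even]
  exact fun h => this.1 h Iff.rfl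

lemma IsCycleEdgeSet.subset_edgeSet (h : IsCycleEdgeSet H σ) : σ ⊆ H.edgeSet := by
  obtain ⟨u, p, hp, rfl⟩ := h
  exact fun e he => p.edges_subset_edgeSet he

lemma IsCycleEdgeSet.three_le_ncard (h : IsCycleEdgeSet H σ) : 3 ≤ σ.ncard := by
  classical
  obtain ⟨u, p, hp, rfl⟩ := h
  have : {e | e ∈ p.edges} = (p.edges.toFinset : Set (Sym2 V)) := by ext; simp
  rw [this, Set.ncard_coe_finset, List.toFinset_card_of_nodup hp.isTrail.edges_nodup,
    SimpleGraph.Walk.length_edges]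
  exact hp.three_le_length

lemma SimpleGraph.Walk.IsPath.eq_cons_of_mem_edges {u v w : V} {r : H.Walk u w} (hr : r.IsPath)
    (h : s(u, v) ∈ r.edges) : ∃ (huv : H.Adj u v) (r' : H.Walk v w), r = .cons huv r' := by
  cases r with
  | nil => simp at h
  | @cons _ x _ hx q =>
    rw [SimpleGraph.Walk.edges_cons, List.mem_cons] at h
    rw [SimpleGraph.Walk.isPath_def, SimpleGraph.Walk.support_cons, List.nodup_cons] at hr
    rcases h with h | h
    · have : v = x := Sym2.congr_right.1 h
      subst this
      exact ⟨hx, q, rfl⟩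
    · exact absurd (q.fst_mem_support_of_mem_edges h) hr.1

/-- A cycle through an edge is this edge together with a path between its ends. -/
lemma IsCycleEdgeSet.exists_path (h : IsCycleEdgeSet H σ) {u v : V} (huv : s(u, v) ∈ σ) :
    ∃ q : H.Walk v u, q.IsPath ∧ s(u, v) ∉ q.edges ∧ σ = insert s(u, v) {e | e ∈ q.edges} := by
  classical
  obtain ⟨x, p, hp, rfl⟩ := h
  have hu : u ∈ p.support := p.fst_mem_support_of_mem_edges huv
  obtain ⟨p', hp', hpe⟩ : ∃ p' : H.Walk u u, p'.IsCycle ∧ ∀ e, e ∈ p'.edges ↔ e ∈ p.edges :=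
    ⟨p.rotate u hu, hp.rotate hu, fun e => (p.rotate_edges u hu).mem_iff⟩
  have key : ∀ (hadj : H.Adj u v) (q : H.Walk v u), (SimpleGraph.Walk.cons hadj q).IsCycle →
      (∀ e, e ∈ (SimpleGraph.Walk.cons hadj q).edges ↔ e ∈ p.edges) →
      ∃ q : H.Walk v u, q.IsPath ∧ s(u, v) ∉ q.edges ∧
        {e | e ∈ p.edges} = insert s(u, v) {e | e ∈ q.edges} := by
    intro hadj q hq hqe
    rw [SimpleGraph.Walk.cons_isCycle_iff] at hq
    refine ⟨q, hq.1, hq.2, ?_⟩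
    ext e
    simp [← hqe e]
  cases hpc : p' with
  | nil => subst hpc; simp at hp'
  | @cons _ w _ hw q =>
    subst hpc
    have hq := (SimpleGraph.Walk.cons_isCycle_iff q hw).1 hp'
    have he := (hpe s(u, v)).2 huv
    rw [SimpleGraph.Walk.edges_cons, List.mem_cons] at he
    rcases he with he | he
    · have : v = w := Sym2.congr_right.1 he
      subst this
      exact key hw q hp' hpe
    · obtain ⟨hadj, r', hr'⟩ := hq.1.reverse.eq_cons_of_mem_edges
        (show s(u, v) ∈ q.reverse.edges by simpa using he)
      have hrev : (SimpleGraph.Walk.cons hw q).reverse =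
          .cons hadj (r'.append (.cons hw.symm .nil)) := by
        rw [SimpleGraph.Walk.reverse_cons, hr', SimpleGraph.Walk.cons_append]
      refine key hadj _ (hrev ▸ hp'.reverse) fun e => ?_
      rw [← hrev, SimpleGraph.Walk.edges_reverse, List.mem_reverse]
      exact hpe e

/-- An edge of a path is the only edge of the path in some cut separating its ends. -/
lemma SimpleGraph.Walk.IsPath.exists_cut {u v : V} {q : H.Walk v u} (hq : q.IsPath) {f : Sym2 V}
    (hf : f ∈ q.edges) : ∃ W : Set V, v ∈ W ∧ u ∉ W ∧ ∀ g ∈ q.edges, EdgeCrosses W g ↔ g = f := by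
  induction q with
  | nil => simp at hf
  | @cons v x u h q ih =>
    rw [SimpleGraph.Walk.isPath_def, SimpleGraph.Walk.support_cons, List.nodup_cons,
      ← SimpleGraph.Walk.isPath_def] at hq
    have hnot : ∀ g ∈ q.edges, v ∉ g := fun g hg hv =>
      hq.1 (SimpleGraph.Walk.mem_support_of_mem_edges hg hv)
    have hvu : u ≠ v := by rintro rfl; exact hq.1 q.end_mem_support
    rw [SimpleGraph.Walk.edges_cons, List.mem_cons] at hf
    by_cases hfe : f = s(v, x)
    · subst hfe
      refine ⟨{v}, rfl, hvu, fun g hg => ?_⟩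
      rw [SimpleGraph.Walk.edges_cons, List.mem_cons] at hg
      constructor
      · rintro ⟨a, rfl, b, hb, rfl⟩
        rcases hg with hg | hg
        · exact hg
        · exact absurd (Sym2.mem_mk_left a b) (hnot _ hg)
      · rintro rfl
        exact ⟨v, rfl, x, h.ne', rfl⟩
    · have hf' := hf.resolve_left hfe
      obtain ⟨W, hxW, huW, hW⟩ := ih hq.2 hf'
      refine ⟨insert v W, Set.mem_insert _ _, ?_, fun g hg => ?_⟩
      · rw [Set.mem_insert_iff, not_or]; exact ⟨hvu, huW⟩
      rw [SimpleGraph.Walk.edges_cons, List.mem_cons] at hg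
      by_cases hge : g = s(v, x)
      · subst hge
        rw [edgeCrosses_mk]
        simp [hxW, Ne.symm hfe]
      · have hg' := hg.resolve_left hge
        rw [← hW g hg']
        have hvg := hnot g hg'
        induction g using Sym2.ind with
        | _ a b =>
          have hav : a ≠ v := by rintro rfl; exact hvg (Sym2.mem_mk_left _ _)
          have hbv : b ≠ v := by rintro rfl; exact hvg (Sym2.mem_mk_right _ _)
          simp [edgeCrosses_mk, hav, hbv]

/-- If `τ` contains `s(u, v)` but misses an edge `f` of the cycle, the cut of the path between `u`
and `v` that isolates `f` meets `τ` in `s(u, v)` alone, an odd number of edges. -/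
lemma IsCycleEdgeSet.eq_of_isEvenEdgeSet_subset (h : IsCycleEdgeSet H σ)
    {τ : Set (Sym2 V)} (hτ : IsEvenEdgeSet τ) (hne : τ.Nonempty) (hsub : τ ⊆ σ) : τ = σ := by
  refine Set.Subset.antisymm hsub fun f hf => ?_
  by_contra hfτ
  obtain ⟨e, he⟩ := hne
  induction e using Sym2.ind with
  | _ u v =>
    obtain ⟨q, hq, huvq, hσ⟩ := h.exists_path (hsub he)
    have hfe : f ≠ s(u, v) := by rintro rfl; exact hfτ he
    have hfq : f ∈ q.edges := by
      rw [hσ] at hf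
      exact hf.resolve_left hfe
    obtain ⟨W, hvW, huW, hW⟩ := hq.exists_cut hfq
    have heq : {g | g ∈ τ ∧ EdgeCrosses W g} = {s(u, v)} := by
      ext g
      simp only [Set.mem_ofPred_eq, Set.mem_singleton_iff]
      constructor
      · rintro ⟨hgτ, hgW⟩
        have hg := hsub hgτ
        rw [hσ] at hg
        rcases hg with hg | hg
        · exact hg
        · exact absurd ((hW g hg).1 hgW ▸ hgτ) hfτ
      · rintro rfl
        exact ⟨he, edgeCrosses_mk.2 (Or.inr ⟨hvW, huW⟩)⟩
    have := hτ W
    rw [heq, Set.ncard_singleton] at this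
    exact absurd this (by decide)

/-- In a forest every edge is a bridge, and the component on one side of a bridge gives a cut with
exactly one edge. So the graph formed by a nonempty even set is not acyclic. -/
lemma IsEvenEdgeSet.exists_cycle_subset {D : Set (Sym2 V)} (hD : IsEvenEdgeSet D)
    (hne : D.Nonempty) (hDH : D ⊆ H.edgeSet) : ∃ τ ⊆ D, IsCycleEdgeSet H τ := by
  classical
  let K := SimpleGraph.fromEdgeSet D
  have hK : K.edgeSet = D := by
    rw [SimpleGraph.edgeSet_fromEdgeSet]
    refine sdiff_eq_left.2 (Set.disjoint_left.2 fun e he hd => ?_)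
    exact H.not_isDiag_of_mem_edgeSet (hDH he) hd
  have hKH : K ≤ H := SimpleGraph.edgeSet_subset_edgeSet.1 (hK.symm ▸ hDH)
  by_cases hac : K.IsAcyclic
  · exfalso
    obtain ⟨e, he⟩ := hne
    induction e using Sym2.ind with
    | _ u v =>
      have hadj : K.Adj u v := by
        rw [← SimpleGraph.mem_edgeSet, hK]; exact he
      have hb := SimpleGraph.isAcyclic_iff_forall_adj_isBridge.1 hac hadj
      rw [SimpleGraph.isBridge_iff] at hb
      let W : Set V := {x | (K.deleteEdges {s(u, v)}).Reachable u x}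
      have huW : u ∈ W := SimpleGraph.Reachable.refl u
      have heq : {g | g ∈ D ∧ EdgeCrosses W g} = {s(u, v)} := by
        ext g
        simp only [Set.mem_ofPred_eq, Set.mem_singleton_iff]
        constructor
        · rintro ⟨hgD, a, ha, b, hb', rfl⟩
          by_contra hne
          refine hb' (SimpleGraph.Reachable.trans ha (SimpleGraph.Adj.reachable ?_))
          rw [SimpleGraph.deleteEdges_adj]
          refine ⟨?_, hne⟩
          rw [← SimpleGraph.mem_edgeSet, hK]; exact hgD
        · rintro rfl
          exact ⟨he, edgeCrosses_mk.2 (Or.inl ⟨huW, hb⟩)⟩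
      have := hD W
      rw [heq, Set.ncard_singleton] at this
      exact absurd this (by decide)
  · unfold SimpleGraph.IsAcyclic at hac
    push Not at hac
    obtain ⟨x, p, hp⟩ := hac
    refine ⟨{e | e ∈ p.edges}, fun e he => hK ▸ p.edges_subset_edgeSet he, x, p.mapLe hKH,
      (SimpleGraph.Walk.isCycle_mapLe hKH).2 hp, ?_⟩
    rw [SimpleGraph.Walk.edges_mapLe_eq_edges]

end EvenEdgeSets

/-! ### Continuous logarithms and separation in the plane. -/

section ContinuousLogarithms

/-- The function `f` has a continuous logarithm on `s`. -/
def HasLogOn (f : ℂ → ℂ) (s : Set ℂ) : Prop :=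
  ∃ g : ℂ → ℂ, ContinuousOn g s ∧ ∀ z ∈ s, Complex.exp (g z) = f z

variable {f f' : ℂ → ℂ} {s t : Set ℂ}

lemma HasLogOn.mono (h : HasLogOn f s) (hts : t ⊆ s) : HasLogOn f t := by
  obtain ⟨g, hg, he⟩ := h
  exact ⟨g, hg.mono hts, fun z hz => he z (hts hz)⟩

lemma HasLogOn.congr (h : HasLogOn f s) (hf : ∀ z ∈ s, f z = f' z) : HasLogOn f' s := by
  obtain ⟨g, hg, he⟩ := h
  exact ⟨g, hg, fun z hz => (he z hz).trans (hf z hz)⟩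

lemma exists_int_of_exp_eq {x y : ℂ} (h : Complex.exp x = Complex.exp y) :
    ∃ n : ℤ, x = y + n * (2 * Real.pi * Complex.I) :=
  Complex.exp_eq_exp_iff_exists_int.1 h

lemma exp_add_int_mul_two_pi (x : ℂ) (n : ℤ) :
    Complex.exp (x + n * (2 * Real.pi * Complex.I)) = Complex.exp x :=
  Complex.exp_eq_exp_iff_exists_int.2 ⟨n, rfl⟩

lemma int_mul_two_pi_injective {m n : ℤ}
    (h : (m : ℂ) * (2 * Real.pi * Complex.I) = n * (2 * Real.pi * Complex.I)) : m = n := by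
  have h1 := mul_right_cancel₀ Complex.two_pi_I_ne_zero h
  exact_mod_cast h1

/-- Two continuous logarithms of a function on a preconnected set differ by a constant. -/
lemma exists_int_of_exp_eqOn {X : Type*} [TopologicalSpace X] {s : Set X} (hs : IsPreconnected s)
    {g h : X → ℂ} (hg : ContinuousOn g s) (hh : ContinuousOn h s)
    (he : ∀ z ∈ s, Complex.exp (g z) = Complex.exp (h z)) :
    ∃ n : ℤ, ∀ z ∈ s, g z = h z + n * (2 * Real.pi * Complex.I) := by
  rcases s.eq_empty_or_nonempty with rfl | ⟨a, ha⟩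
  · exact ⟨0, fun z hz => absurd hz (Set.notMem_empty z)⟩
  obtain ⟨n, hn⟩ := exists_int_of_exp_eq (he a ha)
  refine ⟨n, fun z hz => ?_⟩
  refine Complex.isCoveringMap_exp.eqOn_of_comp_eqOn (g₁ := g)
    (g₂ := fun z => h z + n * (2 * Real.pi * Complex.I)) hs hg
    (hh.add continuousOn_const) (fun w hw => ?_) ha hn hz
  simp only [Function.comp_apply, exp_add_int_mul_two_pi, he w hw]

lemma hasLogOn_univ_of_continuous (hf : Continuous f) (h0 : ∀ z, f z ≠ 0) :
    HasLogOn f Set.univ := by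
  obtain ⟨F, ⟨-, hF⟩, -⟩ := Complex.isCoveringMapOn_exp.existsUnique_continuousMap_lifts
    ⟨f, hf⟩ (a₀ := 0) (Complex.exp_log (h0 0)) h0
  exact ⟨F, F.continuous.continuousOn, fun z _ => congr_fun hF z⟩

lemma hasLogOn_range_arc {p : unitInterval → ℂ} (hp : Continuous p) (hinj : Function.Injective p)
    (hf : ContinuousOn f (Set.range p)) (h0 : ∀ z ∈ Set.range p, f z ≠ 0) :
    HasLogOn f (Set.range p) := by
  have hemb : Topology.IsClosedEmbedding p := hp.isClosedEmbedding hinj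
  have hfp : Continuous fun t => f (p t) :=
    hf.comp_continuous hp fun t => Set.mem_range_self t
  let γ : C(unitInterval, {z : ℂ // z ≠ 0}) :=
    ⟨fun t => ⟨f (p t), h0 _ (Set.mem_range_self t)⟩, hfp.subtype_mk _⟩
  obtain ⟨Γ, hΓ, -⟩ := Complex.isCoveringMap_exp.exists_path_lifts γ (Complex.log (f (p 0)))
    (Subtype.ext (Complex.exp_log (h0 _ (Set.mem_range_self 0))).symm)
  have hg : ∀ t, Function.extend p Γ 0 (p t) = Γ t := fun t => hinj.extend_apply _ _ _
  refine ⟨Function.extend p Γ 0, ?_, ?_⟩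
  · have h1 : Continuous fun z : Set.range p => Γ (hemb.isEmbedding.toHomeomorph.symm z) :=
      Γ.continuous.comp (Homeomorph.continuous _)
    rw [continuousOn_iff_continuous_domRestrict]
    convert h1 using 1
    ext ⟨z, t, rfl⟩
    have : hemb.isEmbedding.toHomeomorph.symm ⟨p t, t, rfl⟩ = t := by
      rw [Homeomorph.symm_apply_eq]; rfl
    rw [this]
    exact hg t
  · rintro z ⟨t, rfl⟩
    rw [hg]
    exact congr_arg Subtype.val (congr_fun hΓ t)

/-- Moving the pole along the path from `a` to `b` gives a homotopy from the constant `1` to the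
quotient through functions without zeros on `K`. It lifts through `exp`, starting from the logarithm
`0`. -/
lemma JoinedIn.hasLogOn {K : Set ℂ} {a b : ℂ} (h : JoinedIn Kᶜ a b) :
    HasLogOn (fun z => (z - a) / (z - b)) K := by
  obtain ⟨γ, hγ⟩ := h
  have hne : ∀ (t : unitInterval) (z : K), (z : ℂ) - γ t ≠ 0 := fun t z hz =>
    hγ t (sub_eq_zero.1 hz ▸ z.2)
  have hne' : ∀ (z : K), (z : ℂ) - a ≠ 0 := fun z => by simpa using hne 0 z
  let H : C(unitInterval × K, {z : ℂ // z ≠ 0}) :=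
    ⟨fun x => ⟨((x.2 : ℂ) - a) / (x.2 - γ x.1), div_ne_zero (hne' _) (hne _ _)⟩, by
      refine Continuous.subtype_mk (Continuous.div (by fun_prop) (by fun_prop) ?_) _
      exact fun x => hne _ _⟩
  have hH : ∀ z : K, H (0, z) = (fun z : ℂ ↦ (⟨_, z.exp_ne_zero⟩ : {z : ℂ // z ≠ 0}))
      ((0 : C(K, ℂ)) z) := by
    intro z
    apply Subtype.ext
    simp [H, div_self (hne' z)]
  let L := Complex.isCoveringMap_exp.liftHomotopy H 0 hH
  have hL : ∀ z : K, Complex.exp (L (1, z)) = ((z : ℂ) - a) / (z - b) := by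
    intro z
    have h1 := congr_arg Subtype.val
      (congr_fun (Complex.isCoveringMap_exp.liftHomotopy_lifts H 0 hH) (1, z))
    exact h1.trans (by simp [H])
  classical
  refine ⟨fun z => if hz : z ∈ K then L (1, ⟨z, hz⟩) else 0, ?_, fun z hz => ?_⟩
  · rw [continuousOn_iff_continuous_domRestrict]
    have h1 : Continuous fun z : K => L (1, z) := by fun_prop
    convert h1 using 1
    ext z
    simp
  · simp only [hz, dif_pos]
    exact hL ⟨z, hz⟩

/-- Along the circle a logarithm of `(z - a) ^ n` has the form `n * (log r + i θ)` up to a constant,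
and it must return to its value after one turn. -/
lemma eq_zero_of_hasLogOn_sphere {a : ℂ} {r : ℝ} (hr : 0 < r) {n : ℤ}
    (h : HasLogOn (fun z => (z - a) ^ n) (Metric.sphere a r)) : n = 0 := by
  obtain ⟨g, hg, he⟩ := h
  have hmem : ∀ θ : ℝ, circleMap a r θ ∈ Metric.sphere a r :=
    fun θ => circleMap_mem_sphere a hr.le θ
  have h1 : Continuous fun θ : ℝ => g (circleMap a r θ) :=
    hg.comp_continuous (continuous_circleMap a r) hmem
  have h2 : Continuous fun θ : ℝ => (n : ℂ) * (Complex.log r + θ * Complex.I) := by fun_prop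
  have hr' : (r : ℂ) ≠ 0 := by exact_mod_cast hr.ne'
  obtain ⟨m, hm⟩ := exists_int_of_exp_eqOn isPreconnected_univ h1.continuousOn h2.continuousOn
    (fun θ _ => by
      rw [he _ (hmem θ), Complex.exp_int_mul, Complex.exp_add, Complex.exp_log hr']
      simp [circleMap])
  have h3 := hm 0 trivial
  have h4 := hm (2 * Real.pi) trivial
  have h5 : circleMap a r (2 * Real.pi) = circleMap a r 0 := by
    simpa using periodic_circleMap a r 0
  simp only [h5, h3] at h4
  have h6 : (n : ℂ) * (2 * Real.pi * Complex.I) = ((0 : ℤ) : ℂ) * (2 * Real.pi * Complex.I) := by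
    push_cast at h4 ⊢
    linear_combination -h4
  exact int_mul_two_pi_injective h6

lemma closure_connectedComponentIn_compl_subset {K : Set ℂ} (hK : IsClosed K) (a : ℂ) :
    closure (connectedComponentIn Kᶜ a) ⊆ connectedComponentIn Kᶜ a ∪ K := by
  intro w hw
  by_cases hwK : w ∈ K
  · exact Or.inr hwK
  left
  have hopen : IsOpen (connectedComponentIn Kᶜ w) := hK.isOpen_compl.connectedComponentIn
  obtain ⟨x, hx, hxa⟩ := mem_closure_iff.1 hw _ hopen (mem_connectedComponentIn hwK)
  rw [connectedComponentIn_eq hxa, ← connectedComponentIn_eq hx]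
  exact mem_connectedComponentIn hwK

lemma frontier_connectedComponentIn_compl_subset {K : Set ℂ} (hK : IsClosed K) (a : ℂ) :
    frontier (connectedComponentIn Kᶜ a) ⊆ K := by
  intro w hw
  have hopen : IsOpen (connectedComponentIn Kᶜ a) := hK.isOpen_compl.connectedComponentIn
  rw [hopen.frontier_eq] at hw
  exact (closure_connectedComponentIn_compl_subset hK a hw.1).resolve_left hw.2

/-- The integer `n` vanishes if `(z - a) ^ n * φ z` has a continuous logarithm on `K` and `a` is in
a bounded component of the complement of `K` on which `φ` has no zeros. -/
lemma HasLogOn.eq_zero_of_isBounded {K : Set ℂ} (hK : IsClosed K) {a : ℂ} (ha : a ∉ K)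
    (hb : Bornology.IsBounded (connectedComponentIn Kᶜ a)) {φ : ℂ → ℂ}
    (hφ : ContinuousOn φ (closure (connectedComponentIn Kᶜ a)))
    (hφ0 : ∀ z ∈ closure (connectedComponentIn Kᶜ a), φ z ≠ 0) {n : ℤ}
    (h : HasLogOn (fun z => (z - a) ^ n * φ z) K) : n = 0 := by
  classical
  set U := connectedComponentIn Kᶜ a with hU
  have hUo : IsOpen U := hK.isOpen_compl.connectedComponentIn
  have haU : a ∈ U := mem_connectedComponentIn ha
  obtain ⟨g, hg, he⟩ := h
  -- The logarithm is extended from `K` to the plane by Tietze's theorem.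
  obtain ⟨g', hg'⟩ := ContinuousMap.exists_restrict_eq hK
    ⟨K.domRestrict g, continuousOn_iff_continuous_domRestrict.1 hg⟩
  have hg'K : ∀ z ∈ K, g' z = g z := fun z hz => congr($hg' ⟨z, hz⟩)
  have hne : ∀ z ∉ U, z - a ≠ 0 := by
    intro z hz h
    rw [sub_eq_zero.1 h] at hz
    exact hz haU
  -- Both formulas agree on the frontier of `U`, which lies in `K`. The result has no zeros in the
  -- plane, hence a logarithm there, and it equals `(z - a) ^ n` on a large circle.
  let F : ℂ → ℂ := U.piecewise (fun z => Complex.exp (g' z) / φ z) (fun z => (z - a) ^ n)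
  have hF : Continuous F := by
    refine continuous_piecewise ?_ ?_ ?_
    · intro z hz
      have hzK := frontier_connectedComponentIn_compl_subset hK a hz
      rw [hg'K z hzK, he z hzK]
      exact mul_div_cancel_right₀ _ (hφ0 z (frontier_subset_closure hz))
    · exact ContinuousOn.div (by fun_prop) hφ hφ0
    · rw [hUo.isClosed_compl.closure_eq]
      exact ContinuousOn.zpow₀ (by fun_prop) n fun z hz => Or.inl (hne z hz)
  have hF0 : ∀ z, F z ≠ 0 := by
    intro z
    by_cases hz : z ∈ U
    · simp only [F, Set.piecewise_eq_of_mem _ _ _ hz]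
      exact div_ne_zero (Complex.exp_ne_zero _) (hφ0 z (subset_closure hz))
    · simp only [F, Set.piecewise_eq_of_notMem _ _ _ hz]
      exact zpow_ne_zero _ (hne z hz)
  obtain ⟨r, hr0, hr⟩ := hb.subset_ball_lt 0 a
  refine eq_zero_of_hasLogOn_sphere (a := a) hr0
    (((hasLogOn_univ_of_continuous hF hF0).mono (Set.subset_univ _)).congr fun z hz => ?_)
  refine Set.piecewise_eq_of_notMem _ _ _ fun hzU => ?_
  exact (Metric.mem_ball.1 (hr hzU)).ne (Metric.mem_sphere.1 hz)

lemma connectedComponentIn_compl_sphere_subset_ball {a : ℂ} {r : ℝ} (hr : 0 < r) :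
    connectedComponentIn (Metric.sphere a r)ᶜ a ⊆ Metric.ball a r := by
  have haS : a ∈ (Metric.sphere a r)ᶜ := by simp [hr.ne]
  refine isPreconnected_connectedComponentIn.subset_left_of_subset_union (v := (Metric.closedBall a r)ᶜ)
    Metric.isOpen_ball Metric.isClosed_closedBall.isOpen_compl ?_ ?_ ?_
  · exact Set.disjoint_left.2 fun z hz hz' => hz' (Metric.ball_subset_closedBall hz)
  · intro z hz
    have := connectedComponentIn_subset _ _ hz
    rcases lt_trichotomy (dist z a) r with h | h | h
    · exact Or.inl h
    · exact absurd h this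
    · exact Or.inr (by simpa using h)
  · exact ⟨a, mem_connectedComponentIn haS, Metric.mem_ball_self hr⟩

/-- On a circle about `a` that leaves `b` outside, only the zero at `a` contributes to the winding
number. -/
lemma not_hasLogOn_compl_pair {a b : ℂ} (hab : a ≠ b) :
    ¬ HasLogOn (fun z => (z - a) / (z - b)) ({a, b} : Set ℂ)ᶜ := by
  intro h
  have hr : 0 < dist b a / 2 := by have := dist_pos.2 hab.symm; positivity
  have hsub := connectedComponentIn_compl_sphere_subset_ball (a := a) hr
  have hcl : closure (connectedComponentIn (Metric.sphere a (dist b a / 2))ᶜ a) ⊆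
      Metric.closedBall a (dist b a / 2) :=
    (closure_mono hsub).trans Metric.closure_ball_subset_closedBall
  have hne : ∀ z ∈ closure (connectedComponentIn (Metric.sphere a (dist b a / 2))ᶜ a),
      z - b ≠ 0 := by
    intro z hz h0
    have := Metric.mem_closedBall.1 (hcl hz)
    rw [sub_eq_zero.1 h0] at this
    linarith
  have := HasLogOn.eq_zero_of_isBounded (n := 1) (φ := fun z => (z - b)⁻¹) Metric.isClosed_sphere
    (by simp [hr.ne]) (Metric.isBounded_ball.subset hsub)
    (ContinuousOn.inv₀ (by fun_prop) hne) (fun z hz => inv_ne_zero (hne z hz))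
    ((h.mono ?_).congr fun z _ => by rw [zpow_one, div_eq_mul_inv])
  · exact one_ne_zero this
  · intro z hz hz'
    rcases hz' with rfl | rfl
    · simp [hr.ne] at hz
    · have := Metric.mem_sphere.1 hz
      linarith

end ContinuousLogarithms

/-! ### How an arc changes the components of the complement. -/

section ArcsInThePlane

lemma isPreconnected_setOf_lt_norm {r : ℝ} (hr : 0 < r) : IsPreconnected {z : ℂ | r < ‖z‖} := by
  have h : {z : ℂ | r < ‖z‖} = Complex.exp '' {w | Real.log r < w.re} := by
    ext z
    constructor
    · intro hz
      have hz0 : z ≠ 0 := norm_pos_iff.1 (hr.trans hz)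
      refine ⟨Complex.log z, ?_, Complex.exp_log hz0⟩
      show Real.log r < (Complex.log z).re
      rw [Complex.log_re]
      exact Real.log_lt_log hr hz
    · rintro ⟨w, hw, rfl⟩
      show r < ‖Complex.exp w‖
      rw [Complex.norm_exp, ← Real.log_lt_iff_lt_exp hr]
      exact hw
  rw [h]
  exact (convex_halfSpace_re_gt _).isPreconnected.image _ Complex.continuous_exp.continuousOn

/-- The complement of a bounded set has at most one unbounded component. -/
lemma connectedComponentIn_compl_eq_of_not_isBounded {K : Set ℂ} (hK : Bornology.IsBounded K)
    {a b : ℂ} (ha : ¬ Bornology.IsBounded (connectedComponentIn Kᶜ a))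
    (hb : ¬ Bornology.IsBounded (connectedComponentIn Kᶜ b)) :
    connectedComponentIn Kᶜ a = connectedComponentIn Kᶜ b := by
  obtain ⟨r, hr0, hr⟩ := hK.subset_ball_lt 0 0
  have hfar : ∀ c, ¬ Bornology.IsBounded (connectedComponentIn Kᶜ c) →
      ∃ z ∈ connectedComponentIn Kᶜ c, r < ‖z‖ := by
    intro c hc
    by_contra! h
    exact hc ((Metric.isBounded_closedBall (x := 0) (r := r)).subset fun z hz => by
      simpa using h z hz)
  obtain ⟨x, hx, hxr⟩ := hfar a ha
  obtain ⟨y, hy, hyr⟩ := hfar b hb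
  have hsub : {z : ℂ | r < ‖z‖} ⊆ Kᶜ := by
    intro z hz hzK
    have := hr hzK
    simp only [Metric.mem_ball, dist_zero_right] at this
    exact lt_asymm this hz
  have hyx := (isPreconnected_setOf_lt_norm hr0).subset_connectedComponentIn hxr hsub hyr
  rw [connectedComponentIn_eq hx, connectedComponentIn_eq hyx, ← connectedComponentIn_eq hy]

lemma sub_ne_zero_of_mem_closure_connectedComponentIn {K : Set ℂ} (hK : IsClosed K) {a b z : ℂ}
    (hb : b ∉ K) (hab : connectedComponentIn Kᶜ a ≠ connectedComponentIn Kᶜ b)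
    (hz : z ∈ closure (connectedComponentIn Kᶜ a)) : z - b ≠ 0 := by
  intro h
  rw [sub_eq_zero.1 h] at hz
  rcases closure_connectedComponentIn_compl_subset hK a hz with h | h
  · exact hab (connectedComponentIn_eq h)
  · exact hb h

/-- Points at which `(z - a) / (z - b)` has a continuous logarithm on `K` are not separated
by `K`. -/
lemma HasLogOn.connectedComponentIn_eq {K : Set ℂ} (hK : IsCompact K) {a b : ℂ} (ha : a ∉ K)
    (hb : b ∉ K) (h : HasLogOn (fun z => (z - a) / (z - b)) K) :
    connectedComponentIn Kᶜ a = connectedComponentIn Kᶜ b := by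
  by_contra hab
  -- If the component of `a` were bounded, `1 / (z - b)` would have no zeros or poles on its
  -- closure, and the exponent `1` of `z - a` would have to vanish. Exchanging `a` and `b` makes
  -- both components unbounded, hence equal.
  have key : ∀ {a b : ℂ}, a ∉ K → b ∉ K → connectedComponentIn Kᶜ a ≠ connectedComponentIn Kᶜ b →
      HasLogOn (fun z => (z - a) / (z - b)) K →
      ¬ Bornology.IsBounded (connectedComponentIn Kᶜ a) := by
    intro a b ha hb hab h hbd
    have hne := fun z => sub_ne_zero_of_mem_closure_connectedComponentIn hK.isClosed hb hab (z := z)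
    refine one_ne_zero (HasLogOn.eq_zero_of_isBounded (n := 1) (φ := fun z => (z - b)⁻¹)
      hK.isClosed ha hbd (ContinuousOn.inv₀ (by fun_prop) hne)
      (fun z hz => inv_ne_zero (hne z hz)) (h.congr fun z _ => ?_))
    rw [zpow_one, div_eq_mul_inv]
  refine hab (connectedComponentIn_compl_eq_of_not_isBounded hK.isBounded (key ha hb hab h)
    (key hb ha (Ne.symm hab) ?_))
  obtain ⟨g, hg, he⟩ := h
  exact ⟨fun z => -g z, hg.neg, fun z hz => by rw [Complex.exp_neg, he z hz, inv_div]⟩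

lemma hasLogOn_union_of_eqOn_inter {f g h : ℂ → ℂ} {s t : Set ℂ}
    (hst : (IsClosed s ∧ IsClosed t) ∨ (IsOpen s ∧ IsOpen t))
    (hg : ContinuousOn g s) (hge : ∀ z ∈ s, Complex.exp (g z) = f z)
    (hh : ContinuousOn h t) (hhe : ∀ z ∈ t, Complex.exp (h z) = f z)
    (heq : ∀ z ∈ s, z ∈ t → g z = h z) : HasLogOn f (s ∪ t) := by
  classical
  have h1 : ∀ z ∈ s, s.piecewise g h z = g z := fun z hz => Set.piecewise_eq_of_mem _ _ _ hz
  have h2 : ∀ z ∈ t, s.piecewise g h z = h z := by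
    intro z hz
    by_cases hzs : z ∈ s
    · rw [h1 z hzs, heq z hzs hz]
    · exact Set.piecewise_eq_of_notMem _ _ _ hzs
  refine ⟨s.piecewise g h, ?_, ?_⟩
  · rcases hst with hst | hst
    · exact (hg.congr h1).union_of_isClosed (hh.congr h2) hst.1 hst.2
    · exact (hg.congr h1).union_of_isOpen (hh.congr h2) hst.1 hst.2
  · rintro z (hz | hz)
    · rw [h1 z hz, hge z hz]
    · rw [h2 z hz, hhe z hz]

variable {p : ℝ → ℂ} {a b : ℝ}

lemma hasLogOn_arc (hp : Continuous p) (hab : a < b) (hinj : Set.InjOn p (Set.Icc a b))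
    {f : ℂ → ℂ} (hf : ContinuousOn f (p '' Set.Icc a b)) (h0 : ∀ z ∈ p '' Set.Icc a b, f z ≠ 0) :
    HasLogOn f (p '' Set.Icc a b) := by
  let q : unitInterval → ℂ := fun t => p ((iccHomeoI a b hab).symm t)
  have hq : Continuous q := hp.comp (continuous_subtype_val.comp (Homeomorph.continuous _))
  have hqinj : Function.Injective q := fun s t hst =>
    (iccHomeoI a b hab).symm.injective (Subtype.ext (hinj (Subtype.mem _) (Subtype.mem _) hst))
  have hrange : Set.range q = p '' Set.Icc a b := by
    ext z
    constructor
    · rintro ⟨t, rfl⟩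
      exact ⟨_, Subtype.mem _, rfl⟩
    · rintro ⟨t, ht, rfl⟩
      exact ⟨iccHomeoI a b hab ⟨t, ht⟩, by simp only [q, Homeomorph.symm_apply_apply]⟩
  rw [← hrange] at hf h0 ⊢
  exact hasLogOn_range_arc hq hqinj hf h0

lemma isCompact_arc (hp : Continuous p) : IsCompact (p '' Set.Icc a b) :=
  isCompact_Icc.image hp

lemma joinedIn_arc (hp : Continuous p) {s t : ℝ} (hst : s ≤ t) :
    JoinedIn (p '' Set.Icc s t) (p s) (p t) :=
  (((convex_Icc s t).isPathConnected (Set.nonempty_Icc.2 hst)).joinedIn s (Set.left_mem_Icc.2 hst) t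
    (Set.right_mem_Icc.2 hst)).map_continuousOn hp.continuousOn

/-- Every continuous function without zeros on `K` has a continuous logarithm. -/
def HasAllLogs (K : Set ℂ) : Prop :=
  ∀ f : ℂ → ℂ, ContinuousOn f K → (∀ z ∈ K, f z ≠ 0) → HasLogOn f K

lemma HasAllLogs.connectedComponentIn_eq {K : Set ℂ} (hlog : HasAllLogs K) (hK : IsCompact K)
    {x y : ℂ} (hx : x ∉ K) (hy : y ∉ K) :
    connectedComponentIn Kᶜ x = connectedComponentIn Kᶜ y := by
  have hne : ∀ w ∉ K, ∀ z ∈ K, z - w ≠ 0 := by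
    intro w hw z hz h
    exact hw (sub_eq_zero.1 h ▸ hz)
  exact HasLogOn.connectedComponentIn_eq hK hx hy (hlog _
    (ContinuousOn.div (by fun_prop) (by fun_prop) (hne y hy))
    fun z hz => div_ne_zero (hne x hx z hz) (hne y hy z hz))

/-- With at most one common point, a single multiple of the period `2πi` makes the two logarithms
agree. Adding edges one by one then shows that a path of the graph does not separate the plane. -/
lemma HasAllLogs.union_arc {R : Set ℂ} (hlog : HasAllLogs R) (hR : IsClosed R) (hp : Continuous p)
    (hab : a < b) (hinj : Set.InjOn p (Set.Icc a b)) {w : ℂ}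
    (hRe : R ∩ p '' Set.Icc a b ⊆ {w}) : HasAllLogs (R ∪ p '' Set.Icc a b) := by
  intro f hf h0
  obtain ⟨g, hg, hge⟩ := hlog f (hf.mono Set.subset_union_left) fun z hz => h0 z (Or.inl hz)
  obtain ⟨h, hh, hhe⟩ := hasLogOn_arc hp hab hinj (hf.mono Set.subset_union_right)
    fun z hz => h0 z (Or.inr hz)
  obtain ⟨n, hn⟩ : ∃ n : ℤ, ∀ z ∈ R, z ∈ p '' Set.Icc a b →
      g z = h z + n * (2 * Real.pi * Complex.I) := by
    by_cases hw : w ∈ R ∧ w ∈ p '' Set.Icc a b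
    · obtain ⟨n, hn⟩ := exists_int_of_exp_eq ((hge w hw.1).trans (hhe w hw.2).symm)
      refine ⟨n, fun z hz hz' => ?_⟩
      obtain rfl : z = w := hRe ⟨hz, hz'⟩
      exact hn
    · refine ⟨0, fun z hz hz' => ?_⟩
      obtain rfl : z = w := hRe ⟨hz, hz'⟩
      exact absurd ⟨hz, hz'⟩ hw
  exact hasLogOn_union_of_eqOn_inter (h := fun z => h z + n * (2 * Real.pi * Complex.I))
    (Or.inl ⟨hR, (isCompact_arc hp).isClosed⟩) hg hge
    (hh.add continuousOn_const) (fun z hz => by rw [exp_add_int_mul_two_pi, hhe z hz]) hn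

/-- Logarithms of `(z - x) / (z - y)` on a closed set and on an arc meeting it only in its ends can
be chosen to agree at one end and to differ by an integer period at the other end. -/
lemma JoinedIn.exists_logs_on_closed_and_arc {R : Set ℂ} (hp : Continuous p) (hab : a < b)
    (hinj : Set.InjOn p (Set.Icc a b)) {x y : ℂ} (hxy : JoinedIn Rᶜ x y)
    (hx : x ∉ p '' Set.Icc a b) (hy : y ∉ p '' Set.Icc a b) :
    ∃ (n : ℤ) (g h : ℂ → ℂ), ContinuousOn g R ∧ ContinuousOn h (p '' Set.Icc a b) ∧
      (∀ z ∈ R, Complex.exp (g z) = (z - x) / (z - y)) ∧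
      (∀ z ∈ p '' Set.Icc a b, Complex.exp (h z) = (z - x) / (z - y)) ∧
      (p a ∈ R → g (p a) = h (p a)) ∧
      (p b ∈ R → g (p b) = h (p b) + n * (2 * Real.pi * Complex.I)) := by
  have hne : ∀ w ∉ p '' Set.Icc a b, ∀ z ∈ p '' Set.Icc a b, z - w ≠ 0 := by
    intro w hw z hz h
    exact hw (sub_eq_zero.1 h ▸ hz)
  have hpa : p a ∈ p '' Set.Icc a b := ⟨a, Set.left_mem_Icc.2 hab.le, rfl⟩
  have hpb : p b ∈ p '' Set.Icc a b := ⟨b, Set.right_mem_Icc.2 hab.le, rfl⟩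
  obtain ⟨g, hg, hge⟩ := hxy.hasLogOn
  obtain ⟨h, hh, hhe⟩ := hasLogOn_arc hp hab hinj (f := fun z => (z - x) / (z - y))
    (ContinuousOn.div (by fun_prop) (by fun_prop) (hne y hy))
    fun z hz => div_ne_zero (hne x hx z hz) (hne y hy z hz)
  obtain ⟨m, hm⟩ : ∃ m : ℤ, p a ∈ R → g (p a) = h (p a) + m * (2 * Real.pi * Complex.I) := by
    by_cases hR : p a ∈ R
    · obtain ⟨m, hm⟩ := exists_int_of_exp_eq ((hge _ hR).trans (hhe _ hpa).symm)
      exact ⟨m, fun _ => hm⟩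
    · exact ⟨0, fun h => absurd h hR⟩
  obtain ⟨n, hn⟩ : ∃ n : ℤ, p b ∈ R → g (p b) = h (p b) + n * (2 * Real.pi * Complex.I) := by
    by_cases hR : p b ∈ R
    · obtain ⟨n, hn⟩ := exists_int_of_exp_eq ((hge _ hR).trans (hhe _ hpb).symm)
      exact ⟨n, fun _ => hn⟩
    · exact ⟨0, fun h => absurd h hR⟩
  refine ⟨n - m, g, fun z => h z + m * (2 * Real.pi * Complex.I), hg, hh.add continuousOn_const,
    hge, fun z hz => by rw [exp_add_int_mul_two_pi, hhe z hz], hm, fun hR => ?_⟩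
  rw [hn hR]
  push_cast
  ring

/-- Adding an arc to a closed set splits a component of the complement into at most two. -/
theorem connectedComponentIn_compl_union_arc_eq {R : Set ℂ} (hR : IsCompact R) (hp : Continuous p)
    (hab : a < b) (hinj : Set.InjOn p (Set.Icc a b)) (hRe : R ∩ p '' Set.Icc a b ⊆ {p a, p b})
    {x y z : ℂ} (hxy : JoinedIn Rᶜ x y) (hxz : JoinedIn Rᶜ x z)
    (hx : x ∉ p '' Set.Icc a b) (hy : y ∉ p '' Set.Icc a b) (hz : z ∉ p '' Set.Icc a b) :
    connectedComponentIn (R ∪ p '' Set.Icc a b)ᶜ x =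
      connectedComponentIn (R ∪ p '' Set.Icc a b)ᶜ y ∨
    connectedComponentIn (R ∪ p '' Set.Icc a b)ᶜ x =
      connectedComponentIn (R ∪ p '' Set.Icc a b)ᶜ z ∨
    connectedComponentIn (R ∪ p '' Set.Icc a b)ᶜ y =
      connectedComponentIn (R ∪ p '' Set.Icc a b)ᶜ z := by
  obtain ⟨m, g, h, hg, hh, hge, hhe, hga, hgb⟩ :=
    hxy.exists_logs_on_closed_and_arc hp hab hinj hx hy
  obtain ⟨n, g', h', hg', hh', hge', hhe', hga', hgb'⟩ :=
    hxz.exists_logs_on_closed_and_arc hp hab hinj hx hz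
  set e := p '' Set.Icc a b with he
  have hec : IsCompact e := isCompact_arc hp
  have hK : IsCompact (R ∪ e) := hR.union hec
  have hxK : x ∉ R ∪ e := fun h => h.elim hxy.source_mem hx
  have hyK : y ∉ R ∪ e := fun h => h.elim hxy.target_mem hy
  have hzK : z ∉ R ∪ e := fun h => h.elim hxz.target_mem hz
  have hends : ∀ w ∈ R, w ∈ e → w = p a ∨ w = p b := fun w hw hw' => hRe ⟨hw, hw'⟩
  have hcl : (IsClosed R ∧ IsClosed e) ∨ (IsOpen R ∧ IsOpen e) :=
    Or.inl ⟨hR.isClosed, hec.isClosed⟩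
  by_contra! hne
  obtain ⟨hne1, hne2, hne3⟩ := hne
  -- With zero period difference the logarithms would glue, and `x` and `y` would not be separated.
  have hm : m ≠ 0 := by
    rintro rfl
    refine hne1 (HasLogOn.connectedComponentIn_eq hK hxK hyK
      (hasLogOn_union_of_eqOn_inter hcl hg hge hh hhe fun w hw hw' => ?_))
    rcases hends w hw hw' with rfl | rfl
    · exact hga hw
    · simpa using hgb hw
  have hn : n ≠ 0 := by
    rintro rfl
    refine hne2 (HasLogOn.connectedComponentIn_eq hK hxK hzK
      (hasLogOn_union_of_eqOn_inter hcl hg' hge' hh' hhe' fun w hw hw' => ?_))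
    rcases hends w hw hw' with rfl | rfl
    · exact hga' hw
    · simpa using hgb' hw
  -- The exponents `n` and `-m` are chosen so that the period differences at `p b` cancel: `n * m -
  -- m * n = 0`.
  have hlog : HasLogOn (fun w => ((w - x) / (w - y)) ^ n * ((w - x) / (w - z)) ^ (-m)) (R ∪ e) := by
    refine hasLogOn_union_of_eqOn_inter (g := fun w => n * g w - m * g' w)
      (h := fun w => n * h w - m * h' w) hcl ?_ ?_ ?_ ?_ ?_
    · exact (continuousOn_const.mul hg).sub (continuousOn_const.mul hg')
    · intro w hw
      rw [← hge w hw, ← hge' w hw, ← Complex.exp_int_mul, ← Complex.exp_int_mul, ← Complex.exp_add]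
      push_cast
      ring_nf
    · exact (continuousOn_const.mul hh).sub (continuousOn_const.mul hh')
    · intro w hw
      rw [← hhe w hw, ← hhe' w hw, ← Complex.exp_int_mul, ← Complex.exp_int_mul, ← Complex.exp_add]
      push_cast
      ring_nf
    · intro w hw hw'
      rcases hends w hw hw' with rfl | rfl
      · simp only [hga hw, hga' hw]
      · simp only [hgb hw, hgb' hw]
        ring
  have hsub : ∀ {u w : ℂ}, u ∉ R ∪ e → w ∈ R ∪ e → w - u ≠ 0 := by
    intro u w hu hw h
    exact hu (sub_eq_zero.1 h ▸ hw)
  -- The exponents of `w - y` and `w - z` in this product are `-n` and `m`, both nonzero. So neither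
  -- the component of `y` nor that of `z` can be bounded, and the two coincide.
  have hfac : ∀ {u v : ℂ} {k l : ℤ}, u ∉ R ∪ e → v ∉ R ∪ e →
      connectedComponentIn (R ∪ e)ᶜ x ≠ connectedComponentIn (R ∪ e)ᶜ u →
      connectedComponentIn (R ∪ e)ᶜ v ≠ connectedComponentIn (R ∪ e)ᶜ u →
      k ≠ 0 → (∀ w ∈ R ∪ e, ((w - x) / (w - y)) ^ n * ((w - x) / (w - z)) ^ (-m) =
        (w - u) ^ k * ((w - x) ^ (n - m) * (w - v) ^ l)) →
      ¬ Bornology.IsBounded (connectedComponentIn (R ∪ e)ᶜ u) := by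
    intro u v k l hu hv hxu hvu hk hform hbd
    have h1 := fun w => sub_ne_zero_of_mem_closure_connectedComponentIn hK.isClosed hxK hxu.symm
      (z := w)
    have h2 := fun w => sub_ne_zero_of_mem_closure_connectedComponentIn hK.isClosed hv hvu.symm
      (z := w)
    refine hk (HasLogOn.eq_zero_of_isBounded (φ := fun w => (w - x) ^ (n - m) * (w - v) ^ l)
      hK.isClosed hu hbd ?_ ?_ (hlog.congr hform))
    · exact (ContinuousOn.zpow₀ (by fun_prop) _ fun w hw => Or.inl (h1 w hw)).mul
        (ContinuousOn.zpow₀ (by fun_prop) _ fun w hw => Or.inl (h2 w hw))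
    · exact fun w hw => mul_ne_zero (zpow_ne_zero _ (h1 w hw)) (zpow_ne_zero _ (h2 w hw))
  have hform : ∀ w ∈ R ∪ e, ((w - x) / (w - y)) ^ n * ((w - x) / (w - z)) ^ (-m) =
      (w - y) ^ (-n) * ((w - x) ^ (n - m) * (w - z) ^ m) := by
    intro w hw
    rw [div_zpow, div_zpow, zpow_sub₀ (hsub hxK hw), zpow_neg, zpow_neg, zpow_neg, div_eq_mul_inv,
      div_eq_mul_inv, div_eq_mul_inv, inv_inv]
    ring
  refine hne3 (connectedComponentIn_compl_eq_of_not_isBounded hK.isBounded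
    (hfac hyK hzK hne1 hne3.symm (neg_ne_zero.2 hn) hform)
    (hfac (l := -n) hzK hyK hne2 hne3 hm fun w hw => ?_))
  rw [hform w hw]
  ring

/-- If the ends of an arc are joined in a closed set `R` that the arc meets only in its ends, then
the arc separates points of each neighbourhood of its interior. -/
theorem exists_connectedComponentIn_compl_union_arc_ne {R N : Set ℂ}
    (hp : Continuous p) (hab : a < b) (hinj : Set.InjOn p (Set.Icc a b))
    (hjoin : JoinedIn R (p a) (p b)) (hN : IsOpen N) (hNR : Disjoint N R)
    (hNe : p '' Set.Icc a b ⊆ N ∪ {p a, p b}) :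
    ∃ x ∈ N \ p '' Set.Icc a b, ∃ y ∈ N \ p '' Set.Icc a b,
      connectedComponentIn (R ∪ p '' Set.Icc a b)ᶜ x ≠
        connectedComponentIn (R ∪ p '' Set.Icc a b)ᶜ y := by
  by_contra! hall
  set e := p '' Set.Icc a b with he
  have hec : IsClosed e := (isCompact_arc hp).isClosed
  have hpab : p a ≠ p b := fun h =>
    hab.ne (hinj (Set.left_mem_Icc.2 hab.le) (Set.right_mem_Icc.2 hab.le) h)
  -- The quotient `(z - p a) / (z - p b)` has a logarithm off `R` and another off the arc, because
  -- both sets join `p a` to `p b`. If `N` minus the arc met only one component, the two would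
  -- differ by a constant there and glue to a logarithm off the two ends.
  obtain ⟨g, hg, hge⟩ := JoinedIn.hasLogOn (K := Rᶜ) (by rwa [compl_compl])
  obtain ⟨h, hh, hhe⟩ := JoinedIn.hasLogOn (K := eᶜ) (a := p a) (b := p b)
    (by rw [compl_compl]; exact joinedIn_arc hp hab.le)
  have hNsub : N ⊆ Rᶜ := fun z hz hzR => Set.disjoint_left.1 hNR hz hzR
  have hNe' : N \ e ⊆ (R ∪ e)ᶜ := fun z hz hzK => hzK.elim (hNsub hz.1) hz.2
  obtain ⟨n, hn⟩ : ∃ n : ℤ, ∀ z ∈ N, z ∈ eᶜ → g z = h z + n * (2 * Real.pi * Complex.I) := by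
    rcases (N \ e).eq_empty_or_nonempty with hemp | ⟨x, hx⟩
    · refine ⟨0, fun z hz hz' => absurd (show z ∈ N \ e from ⟨hz, hz'⟩) ?_⟩
      rw [hemp]
      exact Set.notMem_empty z
    · have hD : connectedComponentIn (R ∪ e)ᶜ x ⊆ (R ∪ e)ᶜ := connectedComponentIn_subset _ _
      rw [Set.compl_union] at hD
      obtain ⟨n, hn⟩ := exists_int_of_exp_eqOn
        (isPreconnected_connectedComponentIn (F := (R ∪ e)ᶜ) (x := x))
        (hg.mono fun z hz => by rw [Set.compl_union] at hz; exact (hD hz).1)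
        (hh.mono fun z hz => by rw [Set.compl_union] at hz; exact (hD hz).2)
        (fun z hz => by
          rw [Set.compl_union] at hz
          rw [hge z (hD hz).1, hhe z (hD hz).2])
      refine ⟨n, fun z hz hz' => hn z ?_⟩
      rw [hall x hx z ⟨hz, hz'⟩]
      exact mem_connectedComponentIn (hNe' ⟨hz, hz'⟩)
  refine not_hasLogOn_compl_pair hpab ((hasLogOn_union_of_eqOn_inter
    (h := fun z => h z + n * (2 * Real.pi * Complex.I)) (Or.inr ⟨hN, hec.isOpen_compl⟩)
    (hg.mono hNsub) (fun z hz => hge z (hNsub hz))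
    (hh.add continuousOn_const) (fun z hz => by rw [exp_add_int_mul_two_pi, hhe z hz]) hn).mono ?_)
  intro z hz
  by_cases hze : z ∈ e
  · exact Or.inl ((hNe hze).resolve_right hz)
  · exact Or.inr hze

/-- Near an interior point of an arc there are at most two components of the complement. -/
theorem exists_ball_connectedComponentIn_eq {R : Set ℂ} (hR : IsCompact R) (hp : Continuous p)
    (hab : a < b) (hinj : Set.InjOn p (Set.Icc a b)) (hRe : R ∩ p '' Set.Icc a b ⊆ {p a, p b})
    {w : ℂ} (hw : w ∉ R) :
    ∃ ε > 0, Disjoint (Metric.ball w ε) R ∧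
      ∀ x ∈ Metric.ball w ε \ p '' Set.Icc a b, ∀ y ∈ Metric.ball w ε \ p '' Set.Icc a b,
      ∀ z ∈ Metric.ball w ε \ p '' Set.Icc a b,
      connectedComponentIn (R ∪ p '' Set.Icc a b)ᶜ x =
        connectedComponentIn (R ∪ p '' Set.Icc a b)ᶜ y ∨
      connectedComponentIn (R ∪ p '' Set.Icc a b)ᶜ x =
        connectedComponentIn (R ∪ p '' Set.Icc a b)ᶜ z ∨
      connectedComponentIn (R ∪ p '' Set.Icc a b)ᶜ y =
        connectedComponentIn (R ∪ p '' Set.Icc a b)ᶜ z := by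
  obtain ⟨ε, hε, hsub⟩ := Metric.isOpen_iff.1 hR.isClosed.isOpen_compl w hw
  refine ⟨ε, hε, Set.disjoint_left.2 fun z hz => hsub hz, fun x hx y hy z hz => ?_⟩
  have hjoin : ∀ u ∈ Metric.ball w ε, ∀ v ∈ Metric.ball w ε, JoinedIn Rᶜ u v := fun u hu v hv =>
    ((Metric.isPathConnected_ball hε).joinedIn u hu v hv).mono hsub
  exact connectedComponentIn_compl_union_arc_eq hR hp hab hinj hRe (hjoin x hx.1 y hy.1)
    (hjoin x hx.1 z hz.1) hx.2 hy.2 hz.2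

/-- If the ends of an arc are joined outside the arc, there are two components of the complement
near each of its interior points. -/
theorem exists_mem_ball_connectedComponentIn_ne {R : Set ℂ} (hR : IsClosed R) (hp : Continuous p)
    (hinj : Set.InjOn p (Set.Icc a b)) (hRe : R ∩ p '' Set.Icc a b ⊆ {p a, p b})
    (hjoin : JoinedIn R (p a) (p b)) {t : ℝ} (ht : t ∈ Set.Ioo a b) {ε : ℝ} (hε : 0 < ε) :
    ∃ x ∈ Metric.ball (p t) ε, ∃ y ∈ Metric.ball (p t) ε,
      x ∉ R ∪ p '' Set.Icc a b ∧ y ∉ R ∪ p '' Set.Icc a b ∧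
      connectedComponentIn (R ∪ p '' Set.Icc a b)ᶜ x ≠
        connectedComponentIn (R ∪ p '' Set.Icc a b)ᶜ y := by
  obtain ⟨δ, hδ, hball⟩ := Metric.continuous_iff.1 hp t ε hε
  -- The subarc from `s` to `s'` around `t` stays within the ball. The rest of the arc is added to
  -- the closed set, where it joins the ends of the subarc to those of the arc.
  set s := max ((a + t) / 2) (t - δ / 2) with hs
  set s' := min ((b + t) / 2) (t + δ / 2) with hs'
  have hta := ht.1
  have htb := ht.2
  have h1 : a < s := lt_max_of_lt_left (by linarith)
  have h2 : s < t := max_lt (by linarith) (by linarith)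
  have h3 : t < s' := lt_min (by linarith) (by linarith)
  have h4 : s' < b := min_lt_of_left_lt (by linarith)
  have h5 : t - δ / 2 ≤ s := le_max_right _ _
  have h6 : s' ≤ t + δ / 2 := min_le_right _ _
  have hsplit : p '' Set.Icc a b = p '' Set.Icc a s ∪ p '' Set.Icc s' b ∪ p '' Set.Icc s s' := by
    rw [← Set.image_union, ← Set.image_union]
    congr 1
    ext x
    simp only [Set.mem_Icc, Set.mem_union]
    constructor
    · rintro ⟨hx, hx'⟩
      rcases le_total x s with h | h
      · exact Or.inl (Or.inl ⟨hx, h⟩)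
      · rcases le_total x s' with h' | h'
        · exact Or.inr ⟨h, h'⟩
        · exact Or.inl (Or.inr ⟨h', hx'⟩)
    · rintro ((h | h) | h) <;> constructor <;> linarith [h.1, h.2]
  set R' := R ∪ (p '' Set.Icc a s ∪ p '' Set.Icc s' b) with hR'
  have hK : R ∪ p '' Set.Icc a b = R' ∪ p '' Set.Icc s s' := by
    simp only [hsplit, hR', Set.union_assoc]
  have hR'c : IsClosed R' :=
    hR.union ((isCompact_arc hp).isClosed.union (isCompact_arc hp).isClosed)
  have hjoin' : JoinedIn R' (p s) (p s') := by
    have j1 : JoinedIn R' (p a) (p s) := (joinedIn_arc hp h1.le).mono fun z hz => Or.inr (Or.inl hz)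
    have j2 : JoinedIn R' (p s') (p b) :=
      (joinedIn_arc hp h4.le).mono fun z hz => Or.inr (Or.inr hz)
    exact (j1.symm.trans (hjoin.mono fun z hz => Or.inl hz)).trans j2.symm
  have hinj' : ∀ x ∈ Set.Icc a b, ∀ y ∈ Set.Icc a b, p x = p y → x = y := fun x hx y hy =>
    hinj hx hy
  have hinter : ∀ x, s < x → x < s' → p x ∉ R' := by
    intro x hx hx' hxR
    have hxm : x ∈ Set.Icc a b := ⟨by linarith, by linarith⟩
    rcases hxR with h | ⟨y, hy, hyx⟩ | ⟨y, hy, hyx⟩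
    · rcases hRe ⟨h, x, hxm, rfl⟩ with h | h
      · have := hinj' x hxm a ⟨le_refl a, by linarith⟩ h
        linarith
      · have := hinj' x hxm b ⟨by linarith, le_refl b⟩ h
        linarith
    · have := hinj' y ⟨hy.1, by linarith [hy.2]⟩ x hxm hyx
      linarith [hy.2]
    · have := hinj' y ⟨by linarith [hy.1], hy.2⟩ x hxm hyx
      linarith [hy.1]
  obtain ⟨x, hx, y, hy, hxy⟩ := exists_connectedComponentIn_compl_union_arc_ne
    (N := Metric.ball (p t) ε ∩ R'ᶜ) hp (h2.trans h3)
    (hinj.mono (Set.Icc_subset_Icc h1.le h4.le)) hjoin'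
    (Metric.isOpen_ball.inter hR'c.isOpen_compl)
    (Set.disjoint_left.2 fun z hz => hz.2) (by
      rintro z ⟨x, hx, rfl⟩
      rcases eq_or_lt_of_le hx.1 with rfl | hsx
      · exact Or.inr (Or.inl rfl)
      rcases eq_or_lt_of_le hx.2 with rfl | hxs
      · exact Or.inr (Or.inr rfl)
      refine Or.inl ⟨hball x ?_, hinter x hsx hxs⟩
      rw [Real.dist_eq, abs_lt]
      constructor <;> linarith)
  rw [hK]
  exact ⟨x, hx.1.1, y, hy.1.1, fun h => h.elim hx.1.2 hx.2, fun h => h.elim hy.1.2 hy.2, hxy⟩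

end ArcsInThePlane

/-! ### Drawings of edges and cycles. -/

namespace PlaneGraph

variable {V : Type*} (G : PlaneGraph V)

section Drawings

lemma exists_parametrization {u v : V} (h : G.graph.Adj u v) :
    ∃ p : ℝ → ℂ, Continuous p ∧ Set.InjOn p (Set.Icc 0 1) ∧ p 0 = G.point u ∧ p 1 = G.point v ∧
      G.arc s(u, v) = p '' Set.Icc 0 1 := by
  obtain ⟨γ, hγ, harc⟩ := G.isArc u v h
  refine ⟨γ.extend, γ.continuous_extend, ?_, γ.extend_zero, γ.extend_one, ?_⟩
  · intro s hs t ht hst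
    rw [γ.extend_apply hs, γ.extend_apply ht] at hst
    exact congr_arg Subtype.val (hγ hst)
  · rw [harc]
    ext z
    constructor
    · rintro ⟨t, rfl⟩
      exact ⟨t, t.2, γ.extend_apply t.2⟩
    · rintro ⟨t, ht, rfl⟩
      exact ⟨⟨t, ht⟩, (γ.extend_apply ht).symm⟩

variable {G}

lemma point_mem_arc_left {u v : V} (h : G.graph.Adj u v) : G.point u ∈ G.arc s(u, v) := by
  obtain ⟨p, -, -, h0, -, harc⟩ := G.exists_parametrization h
  exact harc ▸ h0 ▸ ⟨0, by simp, rfl⟩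

lemma isCompact_arc_of_mem {e : Sym2 V} (he : e ∈ G.graph.edgeSet) : IsCompact (G.arc e) := by
  induction e using Sym2.ind with
  | _ u v =>
    obtain ⟨p, hp, -, -, -, harc⟩ := G.exists_parametrization he
    exact harc ▸ isCompact_arc hp

/-- Every edge contains a point that is not a vertex. -/
lemma exists_mem_arc_notMem_range_point {e : Sym2 V} (he : e ∈ G.graph.edgeSet) :
    ∃ z ∈ G.arc e, z ∉ Set.range G.point := by
  have he' := he
  induction e using Sym2.ind with
  | _ u v =>
    obtain ⟨p, -, hinj, h0, h1, harc⟩ := G.exists_parametrization he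
    have hmem : p (1 / 2) ∈ G.arc s(u, v) := harc ▸ ⟨1 / 2, by norm_num, rfl⟩
    refine ⟨p (1 / 2), hmem, ?_⟩
    rintro ⟨w, hw⟩
    have hw' := G.mem_of_point_mem_arc _ he' w (hw ▸ hmem)
    rcases Sym2.mem_iff.1 hw' with rfl | rfl
    · have := hinj (x₁ := 0) (x₂ := 1 / 2) (by simp) (by norm_num) (h0.trans hw)
      norm_num at this
    · have := hinj (x₁ := 1) (x₂ := 1 / 2) (by simp) (by norm_num) (h1.trans hw)
      norm_num at this

lemma eq_of_mem_arc_of_mem_arc {e f : Sym2 V} (he : e ∈ G.graph.edgeSet)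
    (hf : f ∈ G.graph.edgeSet) {z : ℂ} (hze : z ∈ G.arc e) (hzf : z ∈ G.arc f)
    (hz : z ∉ Set.range G.point) : e = f := by
  by_contra hne
  obtain ⟨w, -, -, hw⟩ := G.common_end_of_mem_arcs e he f hf hne z hze hzf
  exact hz ⟨w, hw⟩

lemma drawing_mono {C D : Set (Sym2 V)} (h : C ⊆ D) : G.drawing C ⊆ G.drawing D :=
  Set.biUnion_subset_biUnion_left h

lemma drawing_insert (e : Sym2 V) (D : Set (Sym2 V)) :
    G.drawing (insert e D) = G.drawing D ∪ G.arc e := by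
  rw [drawing, Set.biUnion_insert, Set.union_comm, drawing]

lemma drawing_eq_diff_union {e : Sym2 V} {D : Set (Sym2 V)} (he : e ∈ D) :
    G.drawing D = G.drawing (D \ {e}) ∪ G.arc e := by
  rw [← drawing_insert, Set.insert_sdiff_singleton, Set.insert_eq_of_mem he]

lemma mem_of_mem_arc_of_mem_drawing {e : Sym2 V} {D : Set (Sym2 V)} (he : e ∈ G.graph.edgeSet)
    (hD : D ⊆ G.graph.edgeSet) {z : ℂ} (hze : z ∈ G.arc e) (hz : z ∉ Set.range G.point)
    (hzD : z ∈ G.drawing D) : e ∈ D := by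
  obtain ⟨f, hf, hzf⟩ := Set.mem_iUnion₂.1 hzD
  exact eq_of_mem_arc_of_mem_arc he (hD hf) hze hzf hz ▸ hf

lemma isCompact_drawing [Finite V] {D : Set (Sym2 V)} (hD : D ⊆ G.graph.edgeSet) :
    IsCompact (G.drawing D) :=
  (Set.toFinite D).isCompact_biUnion fun _ he => isCompact_arc_of_mem (hD he)

lemma drawing_inter_arc_subset {u v : V} {D : Set (Sym2 V)} (he : s(u, v) ∈ G.graph.edgeSet)
    (hD : D ⊆ G.graph.edgeSet) (heD : s(u, v) ∉ D) :
    G.drawing D ∩ G.arc s(u, v) ⊆ {G.point u, G.point v} := by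
  rintro z ⟨hzD, hze⟩
  obtain ⟨f, hf, hzf⟩ := Set.mem_iUnion₂.1 hzD
  obtain ⟨w, hw, -, rfl⟩ := G.common_end_of_mem_arcs _ he f (hD hf)
    (fun h => heD (h ▸ hf)) z hze hzf
  rcases Sym2.mem_iff.1 hw with rfl | rfl
  · exact Or.inl rfl
  · exact Or.inr rfl

variable (G) in
/-- The vertices together with all edges but one. -/
def rest (e : Sym2 V) : Set ℂ :=
  Set.range G.point ∪ G.drawing (G.graph.edgeSet \ {e})

lemma support_eq_rest_union {e : Sym2 V} (he : e ∈ G.graph.edgeSet) :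
    G.support = G.rest e ∪ G.arc e := by
  rw [support, rest, drawing_eq_diff_union he, Set.union_assoc]

lemma isCompact_rest [Finite V] (e : Sym2 V) : IsCompact (G.rest e) :=
  (Set.finite_range G.point).isCompact.union (isCompact_drawing Set.sdiff_subset)

variable (G) in
lemma isCompact_support [Finite V] : IsCompact G.support :=
  (Set.finite_range G.point).isCompact.union (isCompact_drawing Set.Subset.rfl)

lemma rest_inter_arc_subset {u v : V} (he : s(u, v) ∈ G.graph.edgeSet) :
    G.rest s(u, v) ∩ G.arc s(u, v) ⊆ {G.point u, G.point v} := by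
  rintro z ⟨⟨w, rfl⟩ | hz, hze⟩
  · rcases Sym2.mem_iff.1 (G.mem_of_point_mem_arc _ he w hze) with rfl | rfl
    · exact Or.inl rfl
    · exact Or.inr rfl
  · exact drawing_inter_arc_subset (D := G.graph.edgeSet \ {s(u, v)}) he Set.sdiff_subset
      (fun h => h.2 rfl) ⟨hz, hze⟩

lemma notMem_rest {e : Sym2 V} (he : e ∈ G.graph.edgeSet) {z : ℂ} (hze : z ∈ G.arc e)
    (hz : z ∉ Set.range G.point) : z ∉ G.rest e := by
  rintro (h | h)
  · exact hz h
  · exact (mem_of_mem_arc_of_mem_drawing he Set.sdiff_subset hze hz h).2 rfl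

lemma drawing_subset_support {D : Set (Sym2 V)} (hD : D ⊆ G.graph.edgeSet) :
    G.drawing D ⊆ G.support :=
  (drawing_mono hD).trans Set.subset_union_right

lemma exists_mem_arc_of_mem_support {z : ℂ} (hz : z ∈ G.support) (hzp : z ∉ Set.range G.point) :
    ∃ e ∈ G.graph.edgeSet, z ∈ G.arc e := by
  obtain ⟨e, he, hze⟩ := Set.mem_iUnion₂.1 (hz.resolve_left hzp)
  exact ⟨e, he, hze⟩

end Drawings

section Cycles

variable {G}

lemma joinedIn_of_walk {R : Set ℂ} {u v : V} (q : G.graph.Walk v u)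
    (hq : G.drawing {e | e ∈ q.edges} ⊆ R) (hv : G.point v ∈ R) :
    JoinedIn R (G.point v) (G.point u) := by
  induction q with
  | nil => exact JoinedIn.refl hv
  | @cons v x u h q ih =>
    have hsub : G.arc s(v, x) ⊆ R := by
      refine Set.Subset.trans (fun z hz => ?_) hq
      exact Set.mem_iUnion₂.2 ⟨s(v, x), by simp, hz⟩
    obtain ⟨p, hp, -, h0, h1, harc⟩ := G.exists_parametrization h
    have hj : JoinedIn R (G.point v) (G.point x) := by
      have := (joinedIn_arc hp (zero_le_one (α := ℝ))).mono (harc ▸ hsub)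
      rwa [h0, h1] at this
    refine hj.trans (ih (Set.Subset.trans (drawing_mono fun e he => ?_) hq) hj.target_mem)
    rw [SimpleGraph.Walk.edges_cons]
    exact List.mem_cons_of_mem _ he

lemma hasAllLogs_drawing_of_isPath [Finite V] {u v : V} {q : G.graph.Walk v u} (hq : q.IsPath) :
    HasAllLogs (G.drawing {e | e ∈ q.edges}) := by
  induction q with
  | nil =>
    intro f _ _
    refine ⟨0, continuousOn_const, fun z hz => ?_⟩
    obtain ⟨e, he, -⟩ := Set.mem_iUnion₂.1 hz
    simp at he
  | @cons v x u h q ih =>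
    rw [SimpleGraph.Walk.isPath_def, SimpleGraph.Walk.support_cons, List.nodup_cons,
      ← SimpleGraph.Walk.isPath_def] at hq
    obtain ⟨p, hp, hinj, -, -, harc⟩ := G.exists_parametrization h
    have hsub : {e | e ∈ q.edges} ⊆ G.graph.edgeSet := fun e he => q.edges_subset_edgeSet he
    have hset : {e | e ∈ (SimpleGraph.Walk.cons h q).edges} = insert s(v, x) {e | e ∈ q.edges} := by
      ext e
      simp
    rw [hset, drawing_insert, harc]
    refine (ih hq.2).union_arc (isCompact_drawing hsub).isClosed hp zero_lt_one hinj
      (w := G.point x) ?_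
    rw [← harc]
    rintro z ⟨hzq, hz⟩
    obtain ⟨f, hf, hzf⟩ := Set.mem_iUnion₂.1 hzq
    have hvf : v ∉ f := fun hv => hq.1 (SimpleGraph.Walk.mem_support_of_mem_edges hf hv)
    obtain ⟨w, hw, hwf, rfl⟩ := G.common_end_of_mem_arcs _ h f (hsub hf)
      (fun h => hvf (h ▸ Sym2.mem_mk_left v x)) z hz hzf
    rcases Sym2.mem_iff.1 hw with rfl | rfl
    · exact absurd hwf hvf
    · rfl

variable {σ : Set (Sym2 V)}

/-- The complement of a cycle has at most two components. -/
lemma connectedComponentIn_compl_cycle_eq [Finite V] (hσ : IsCycleEdgeSet G.graph σ) {x y z : ℂ}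
    (hx : x ∉ G.drawing σ) (hy : y ∉ G.drawing σ) (hz : z ∉ G.drawing σ) :
    connectedComponentIn (G.drawing σ)ᶜ x = connectedComponentIn (G.drawing σ)ᶜ y ∨
    connectedComponentIn (G.drawing σ)ᶜ x = connectedComponentIn (G.drawing σ)ᶜ z ∨
    connectedComponentIn (G.drawing σ)ᶜ y = connectedComponentIn (G.drawing σ)ᶜ z := by
  have hne : σ.Nonempty := Set.nonempty_of_ncard_ne_zero (by have := hσ.three_le_ncard; omega)
  obtain ⟨e, he⟩ := hne
  have heG := hσ.subset_edgeSet he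
  induction e using Sym2.ind with
  | _ u v =>
    obtain ⟨q, hq, huvq, hσq⟩ := hσ.exists_path he
    have hsub : {e | e ∈ q.edges} ⊆ G.graph.edgeSet := fun e he => q.edges_subset_edgeSet he
    have hRe := drawing_inter_arc_subset heG hsub huvq
    obtain ⟨p, hp, hinj, h0, h1, harc⟩ := G.exists_parametrization heG
    have hRc := isCompact_drawing hsub
    have hlog := hasAllLogs_drawing_of_isPath hq
    rw [hσq, drawing_insert] at hx hy hz ⊢
    rw [harc] at hx hy hz hRe ⊢
    rw [← h0, ← h1] at hRe
    rw [Set.mem_union, not_or] at hx hy hz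
    -- The cycle without one edge is a path, which does not separate the plane; the last edge then
    -- produces at most two components.
    have hjoin : ∀ w ∉ G.drawing {e | e ∈ q.edges}, JoinedIn (G.drawing {e | e ∈ q.edges})ᶜ x w := by
      intro w hw
      have hopen : IsOpen (connectedComponentIn (G.drawing {e | e ∈ q.edges})ᶜ x) :=
        hRc.isClosed.isOpen_compl.connectedComponentIn
      have hconn : IsConnected (connectedComponentIn (G.drawing {e | e ∈ q.edges})ᶜ x) :=
        isConnected_connectedComponentIn_iff.2 hx.1
      refine ((hopen.isConnected_iff_isPathConnected.1 hconn).joinedIn x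
        (mem_connectedComponentIn hx.1) w ?_).mono (connectedComponentIn_subset _ _)
      rw [hlog.connectedComponentIn_eq hRc hx.1 hw]
      exact mem_connectedComponentIn hw
    exact connectedComponentIn_compl_union_arc_eq hRc hp zero_lt_one hinj hRe (hjoin y hy.1)
      (hjoin z hz.1) hx.2 hy.2 hz.2

/-- A closed set containing a cycle separates points near each interior point of an edge of the
cycle, provided that the rest of the set meets this edge only in its ends. -/
lemma exists_mem_ball_separated_of_cycle (hσ : IsCycleEdgeSet G.graph σ) {u v : V}
    (he : s(u, v) ∈ σ) {R : Set ℂ} (hR : IsClosed R) (hσR : G.drawing (σ \ {s(u, v)}) ⊆ R)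
    (hRe : R ∩ G.arc s(u, v) ⊆ {G.point u, G.point v}) {z : ℂ} (hze : z ∈ G.arc s(u, v))
    (hz : z ∉ Set.range G.point) {ε : ℝ} (hε : 0 < ε) :
    ∃ x ∈ Metric.ball z ε, ∃ y ∈ Metric.ball z ε, x ∉ R ∪ G.arc s(u, v) ∧ y ∉ R ∪ G.arc s(u, v) ∧
      connectedComponentIn (R ∪ G.arc s(u, v))ᶜ x ≠
        connectedComponentIn (R ∪ G.arc s(u, v))ᶜ y := by
  have heG : G.graph.Adj u v := hσ.subset_edgeSet he
  obtain ⟨q, hq, huvq, hσq⟩ := hσ.exists_path he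
  obtain ⟨p, hp, hinj, h0, h1, harc⟩ := G.exists_parametrization heG
  have hdiff : σ \ {s(u, v)} = {e | e ∈ q.edges} := by
    rw [hσq]
    exact Set.insert_sdiff_self_of_notMem huvq
  rw [hdiff] at hσR
  have hvR : G.point v ∈ R := by
    cases q with
    | nil => exact absurd rfl heG.ne
    | @cons _ x _ h q =>
      refine hσR (Set.mem_iUnion₂.2 ⟨s(v, x), by simp, point_mem_arc_left h⟩)
  have hjoin := (joinedIn_of_walk q hσR hvR).symm
  rw [harc] at hRe hze ⊢
  rw [← h0, ← h1] at hRe hjoin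
  obtain ⟨t, ht, rfl⟩ := hze
  refine exists_mem_ball_connectedComponentIn_ne hR hp hinj hRe hjoin ⟨?_, ?_⟩ hε
  · refine lt_of_le_of_ne ht.1 ?_
    rintro rfl
    exact hz ⟨u, h0.symm⟩
  · refine lt_of_le_of_ne ht.2 ?_
    rintro rfl
    exact hz ⟨v, h1.symm⟩

lemma exists_mem_ball_separated_by_cycle [Finite V] (hσ : IsCycleEdgeSet G.graph σ) {e : Sym2 V}
    (he : e ∈ σ) {z : ℂ} (hze : z ∈ G.arc e) (hz : z ∉ Set.range G.point) {ε : ℝ} (hε : 0 < ε) :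
    ∃ x ∈ Metric.ball z ε, ∃ y ∈ Metric.ball z ε, x ∉ G.drawing σ ∧ y ∉ G.drawing σ ∧
      connectedComponentIn (G.drawing σ)ᶜ x ≠ connectedComponentIn (G.drawing σ)ᶜ y := by
  have hsub : σ \ {e} ⊆ G.graph.edgeSet := Set.sdiff_subset.trans hσ.subset_edgeSet
  rw [drawing_eq_diff_union he]
  induction e using Sym2.ind with
  | _ u v =>
    exact exists_mem_ball_separated_of_cycle hσ he (isCompact_drawing hsub).isClosed
      Set.Subset.rfl (drawing_inter_arc_subset (hσ.subset_edgeSet he) hsub fun h => h.2 rfl)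
      hze hz hε

/-- The separation by an edge of a cycle persists when the rest of the cycle is enlarged to all
vertices and all other edges. So two different faces meet along the edge. -/
lemma exists_mem_ball_separated_by_support [Finite V] (hσ : IsCycleEdgeSet G.graph σ) {e : Sym2 V}
    (he : e ∈ σ) {z : ℂ} (hze : z ∈ G.arc e) (hz : z ∉ Set.range G.point) {ε : ℝ} (hε : 0 < ε) :
    ∃ x ∈ Metric.ball z ε, ∃ y ∈ Metric.ball z ε, x ∉ G.support ∧ y ∉ G.support ∧
      connectedComponentIn G.supportᶜ x ≠ connectedComponentIn G.supportᶜ y := by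
  have heG := hσ.subset_edgeSet he
  rw [support_eq_rest_union heG]
  induction e using Sym2.ind with
  | _ u v =>
    exact exists_mem_ball_separated_of_cycle hσ he (isCompact_rest _).isClosed
      ((drawing_mono (Set.sdiff_subset_sdiff_left hσ.subset_edgeSet)).trans Set.subset_union_right)
      (rest_inter_arc_subset heG) hze hz hε

/-- At most two faces come near an interior point of an edge. -/
lemma exists_ball_face_eq [Finite V] {e : Sym2 V} (he : e ∈ G.graph.edgeSet) {z : ℂ}
    (hze : z ∈ G.arc e) (hz : z ∉ Set.range G.point) :
    ∃ ε > 0, (∀ x ∈ Metric.ball z ε, x ∈ G.support → x ∈ G.arc e) ∧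
      ∀ x ∈ Metric.ball z ε, ∀ y ∈ Metric.ball z ε, ∀ w ∈ Metric.ball z ε,
      x ∉ G.support → y ∉ G.support → w ∉ G.support →
      connectedComponentIn G.supportᶜ x = connectedComponentIn G.supportᶜ y ∨
      connectedComponentIn G.supportᶜ x = connectedComponentIn G.supportᶜ w ∨
      connectedComponentIn G.supportᶜ y = connectedComponentIn G.supportᶜ w := by
  have hzR := notMem_rest he hze hz
  rw [support_eq_rest_union he]
  induction e using Sym2.ind with
  | _ u v =>
    have hRe := rest_inter_arc_subset he
    obtain ⟨p, hp, hinj, h0, h1, harc⟩ := G.exists_parametrization he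
    rw [harc, ← h0, ← h1] at hRe
    rw [harc]
    obtain ⟨ε, hε, hdisj, hcomp⟩ :=
      exists_ball_connectedComponentIn_eq (isCompact_rest _) hp zero_lt_one hinj hRe hzR
    refine ⟨ε, hε, fun x hx hxS => hxS.resolve_left (Set.disjoint_left.1 hdisj hx), ?_⟩
    intro x hx y hy w hw hxS hyS hwS
    exact hcomp x ⟨hx, fun h => hxS (Or.inr h)⟩ y ⟨hy, fun h => hyS (Or.inr h)⟩ w
      ⟨hw, fun h => hwS (Or.inr h)⟩

end Cycles

end PlaneGraph

/-! ### Faces, their boundaries and the inside of a cycle. -/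

namespace PlaneGraph

variable {V : Type*} {G : PlaneGraph V}

section Faces

lemma isFace_connectedComponentIn {z : ℂ} (hz : z ∉ G.support) :
    G.IsFace (connectedComponentIn G.supportᶜ z) :=
  ⟨z, hz, rfl⟩

lemma IsFace.eq_connectedComponentIn {F : Set ℂ} (hF : G.IsFace F) {x : ℂ} (hx : x ∈ F) :
    F = connectedComponentIn G.supportᶜ x := by
  obtain ⟨z, -, rfl⟩ := hF
  exact connectedComponentIn_eq hx

lemma IsFace.notMem_support {F : Set ℂ} (hF : G.IsFace F) {x : ℂ} (hx : x ∈ F) :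
    x ∉ G.support := by
  obtain ⟨z, -, rfl⟩ := hF
  exact connectedComponentIn_subset _ _ hx

lemma IsFace.nonempty {F : Set ℂ} (hF : G.IsFace F) : F.Nonempty := by
  obtain ⟨z, hz, rfl⟩ := hF
  exact ⟨z, mem_connectedComponentIn hz⟩

lemma IsFace.isOpen [Finite V] {F : Set ℂ} (hF : G.IsFace F) : IsOpen F := by
  obtain ⟨z, -, rfl⟩ := hF
  exact G.isCompact_support.isClosed.isOpen_compl.connectedComponentIn

lemma IsFace.mem_frontier [Finite V] {F : Set ℂ} (hF : G.IsFace F) {z : ℂ} (hz : z ∈ closure F)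
    (hzS : z ∈ G.support) : z ∈ frontier F := by
  rw [hF.isOpen.frontier_eq]
  exact ⟨hz, fun h => hF.notMem_support h hzS⟩

lemma IsFace.mem_of_mem_closure [Finite V] {F : Set ℂ} (hF : G.IsFace F) {z : ℂ}
    (hz : z ∈ closure F) (hzS : z ∉ G.support) : z ∈ F := by
  obtain ⟨x, -, rfl⟩ := hF
  exact (closure_connectedComponentIn_compl_subset G.isCompact_support.isClosed x hz).resolve_right
    hzS

lemma faceEdges_eq_of_frontier_eq {F : Set ℂ} {C : Set (Sym2 V)} (hC : C ⊆ G.graph.edgeSet)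
    (hF : frontier F = G.drawing C) : G.faceEdges F = C := by
  ext e
  constructor
  · rintro ⟨he, hsub⟩
    obtain ⟨z, hze, hz⟩ := exists_mem_arc_notMem_range_point he
    exact mem_of_mem_arc_of_mem_drawing he hC hze hz (hF ▸ hsub hze)
  · exact fun he => ⟨hC he, hF ▸ Set.subset_biUnion_of_mem he⟩

variable {F : Set ℂ}

lemma IsTriangulated.isCycleEdgeSet_faceEdges (hG : G.IsTriangulated) (hF : G.IsInternalFace F) :
    IsCycleEdgeSet G.graph (G.faceEdges F) := by
  obtain ⟨C, hC, -, hfr⟩ := hG F hF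
  rwa [faceEdges_eq_of_frontier_eq hC.subset_edgeSet hfr]

lemma IsTriangulated.ncard_faceEdges (hG : G.IsTriangulated) (hF : G.IsInternalFace F) :
    (G.faceEdges F).ncard = 3 := by
  obtain ⟨C, hC, hcard, hfr⟩ := hG F hF
  rwa [faceEdges_eq_of_frontier_eq hC.subset_edgeSet hfr]

lemma IsTriangulated.mem_faceEdges [Finite V] (hG : G.IsTriangulated) (hF : G.IsInternalFace F)
    {e : Sym2 V} (he : e ∈ G.graph.edgeSet) {z : ℂ} (hze : z ∈ G.arc e)
    (hz : z ∉ Set.range G.point) (hzF : z ∈ closure F) : e ∈ G.faceEdges F := by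
  obtain ⟨C, hC, -, hfr⟩ := hG F hF
  rw [faceEdges_eq_of_frontier_eq hC.subset_edgeSet hfr]
  have hzS : z ∈ G.support := by
    rw [support_eq_rest_union he]
    exact Or.inr hze
  exact mem_of_mem_arc_of_mem_drawing he hC.subset_edgeSet hze hz
    (hfr ▸ hF.1.mem_frontier hzF hzS)

lemma arc_subset_closure_of_mem_faceEdges {e : Sym2 V} (he : e ∈ G.faceEdges F) :
    G.arc e ⊆ closure F :=
  he.2.trans frontier_subset_closure

lemma exists_mem_ball_of_mem_closure {F : Set ℂ} {z : ℂ} (hz : z ∈ closure F) {ε : ℝ}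
    (hε : 0 < ε) : ∃ x ∈ F, x ∈ Metric.ball z ε := by
  obtain ⟨x, hx, hxz⟩ := Metric.mem_closure_iff.1 hz ε hε
  exact ⟨x, hx, by rwa [Metric.mem_ball, dist_comm]⟩

variable (G) in
/-- The edge sets of the internal faces. -/
abbrev internalFaceEdges (F : {F : Set ℂ // G.IsInternalFace F}) : Set (Sym2 V) :=
  G.faceEdges F.1

lemma faceBoundary_subset_edgeSet (S : Finset {F : Set ℂ // G.IsInternalFace F}) :
    faceBoundary G.internalFaceEdges S ⊆ G.graph.edgeSet :=
  fun _ ⟨_, _, he, _⟩ => he.1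

/-- Every edge is on at most two internal faces. -/
lemma atMostTwoFaces_internalFaceEdges [Finite V] : AtMostTwoFaces G.internalFaceEdges := by
  intro e F₁ F₂ F₃ h1 h2 h3
  obtain ⟨z, hze, hz⟩ := exists_mem_arc_notMem_range_point h1.1
  obtain ⟨ε, hε, -, heq⟩ := exists_ball_face_eq h1.1 hze hz
  obtain ⟨x, hx, hxz⟩ :=
    exists_mem_ball_of_mem_closure (arc_subset_closure_of_mem_faceEdges h1 hze) hε
  obtain ⟨y, hy, hyz⟩ :=
    exists_mem_ball_of_mem_closure (arc_subset_closure_of_mem_faceEdges h2 hze) hε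
  obtain ⟨w, hw, hwz⟩ :=
    exists_mem_ball_of_mem_closure (arc_subset_closure_of_mem_faceEdges h3 hze) hε
  have := heq x hxz y hyz w hwz (F₁.2.1.notMem_support hx) (F₂.2.1.notMem_support hy)
    (F₃.2.1.notMem_support hw)
  rw [← F₁.2.1.eq_connectedComponentIn hx, ← F₂.2.1.eq_connectedComponentIn hy,
    ← F₃.2.1.eq_connectedComponentIn hw] at this
  exact this.imp Subtype.ext fun h => h.imp Subtype.ext Subtype.ext

/-- A nonempty finite set of internal faces has a nonempty boundary. -/
lemma IsTriangulated.faceBoundary_nonempty [Finite V] (hG : G.IsTriangulated)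
    {S : Finset {F : Set ℂ // G.IsInternalFace F}} (hS : S.Nonempty) :
    (faceBoundary G.internalFaceEdges S).Nonempty := by
  by_contra hemp
  rw [Set.not_nonempty_iff_eq_empty] at hemp
  -- With empty boundary, `W` would be a neighbourhood of each of its points that is not a vertex:
  -- along an edge, both adjacent faces belong to `S`. As the plane without finitely many points is
  -- connected, the bounded set `W` would contain all of it.
  let W : Set ℂ := ⋃ F ∈ S, closure F.1
  have hWc : IsClosed W := S.finite_toSet.isClosed_biUnion fun F _ => isClosed_closure
  have hFW : ∀ F ∈ S, closure F.1 ⊆ W := fun F hF =>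
    Set.subset_biUnion_of_mem (u := fun F : {F : Set ℂ // G.IsInternalFace F} => closure F.1) hF
  have hint : ∀ z ∈ W, z ∉ Set.range G.point → z ∈ interior W := by
    intro z hzW hz
    obtain ⟨F, hF, hzF⟩ := Set.mem_iUnion₂.1 hzW
    by_cases hzS : z ∈ G.support
    · obtain ⟨e, he, hze⟩ := exists_mem_arc_of_mem_support hzS hz
      have heF : e ∈ G.internalFaceEdges F := hG.mem_faceEdges F.2 he hze hz hzF
      obtain ⟨F', hF', heF', hne⟩ := exists_other_face_of_notMem_faceBoundary hF heF
        (by rw [hemp]; exact Set.notMem_empty e)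
      obtain ⟨ε, hε, harc, heq⟩ := exists_ball_face_eq he hze hz
      obtain ⟨x, hx, hxz⟩ := exists_mem_ball_of_mem_closure hzF hε
      obtain ⟨y, hy, hyz⟩ :=
        exists_mem_ball_of_mem_closure (arc_subset_closure_of_mem_faceEdges heF' hze) hε
      rw [mem_interior]
      refine ⟨Metric.ball z ε, fun w hw => ?_, Metric.isOpen_ball, Metric.mem_ball_self hε⟩
      by_cases hwS : w ∈ G.support
      · exact hFW F hF (arc_subset_closure_of_mem_faceEdges heF (harc w hw hwS))
      · have h3 := heq x hxz y hyz w hw (F.2.1.notMem_support hx) (F'.2.1.notMem_support hy) hwS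
        rw [← F.2.1.eq_connectedComponentIn hx, ← F'.2.1.eq_connectedComponentIn hy] at h3
        have hw' := mem_connectedComponentIn (F := G.supportᶜ) hwS
        rcases h3 with h3 | h3 | h3
        · exact absurd (Subtype.ext h3).symm hne
        · exact hFW F hF (subset_closure (h3 ▸ hw'))
        · exact hFW F' hF' (subset_closure (h3 ▸ hw'))
    · rw [mem_interior]
      exact ⟨F.1, subset_closure.trans (hFW F hF), F.2.1.isOpen, F.2.1.mem_of_mem_closure hzF hzS⟩
  have hfin : (Set.range G.point).Finite := Set.finite_range _
  have hconn : IsPreconnected (Set.range G.point)ᶜ :=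
    (hfin.countable.isConnected_compl_of_one_lt_rank (by
      rw [Complex.rank_real_complex]; exact Nat.one_lt_ofNat)).isPreconnected
  have hsub : (Set.range G.point)ᶜ ⊆ interior W := by
    refine hconn.subset_of_closure_inter_subset isOpen_interior ?_ ?_
    · obtain ⟨F, hF⟩ := hS
      obtain ⟨x, hx⟩ := F.2.1.nonempty
      have hxp : x ∉ Set.range G.point := fun h => F.2.1.notMem_support hx (Or.inl h)
      exact ⟨x, hxp, hint x (hFW F hF (subset_closure hx)) hxp⟩
    · rintro z ⟨hz, hzp⟩
      exact hint z (closure_minimal interior_subset hWc hz) hzp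
  have hWb : Bornology.IsBounded W :=
    (Bornology.isBounded_biUnion_finset S).2 fun F _ => F.2.2.closure
  refine NormedSpace.unbounded_univ ℝ ℂ ((hWb.union hfin.isBounded).subset fun z _ => ?_)
  by_cases hz : z ∈ Set.range G.point
  · exact Or.inr hz
  · exact Or.inl (interior_subset (hsub hz))

/-- Two faces with the same edges would form a set with empty boundary. This makes the number of
internal faces finite and allows faces to be identified with their edge sets. -/
lemma IsTriangulated.injective_internalFaceEdges [Finite V] (hG : G.IsTriangulated) :
    Function.Injective G.internalFaceEdges := by
  classical
  intro F F' h
  by_contra hne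
  obtain ⟨e, E, hE, heE, hu⟩ := hG.faceBoundary_nonempty (S := {F, F'}) ⟨F, by simp⟩
  have he : e ∈ G.internalFaceEdges F ∧ e ∈ G.internalFaceEdges F' := by
    rw [Finset.mem_insert, Finset.mem_singleton] at hE
    rcases hE with rfl | rfl
    · exact ⟨heE, h ▸ heE⟩
    · exact ⟨h ▸ heE, heE⟩
  exact hne ((hu F (by simp) he.1).trans (hu F' (by simp) he.2).symm)

lemma IsTriangulated.finite_internalFaces [Finite V] (hG : G.IsTriangulated) :
    Finite {F : Set ℂ // G.IsInternalFace F} :=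
  Finite.of_injective _ hG.injective_internalFaceEdges

variable {σ : Set (Sym2 V)}

/-- The complement of a cycle has a bounded component and, near each interior point of an edge of
the cycle, points of this component and points outside it. -/
lemma exists_inside_of_cycle [Finite V] (hσ : IsCycleEdgeSet G.graph σ) :
    ∃ a ∉ G.drawing σ, Bornology.IsBounded (connectedComponentIn (G.drawing σ)ᶜ a) ∧
      ∀ e ∈ σ, ∀ z ∈ G.arc e, z ∉ Set.range G.point → ∀ ε > 0,
      ∃ x ∈ Metric.ball z ε, ∃ y ∈ Metric.ball z ε, x ∉ G.drawing σ ∧ y ∉ G.drawing σ ∧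
        x ∈ connectedComponentIn (G.drawing σ)ᶜ a ∧ y ∉ connectedComponentIn (G.drawing σ)ᶜ a := by
  have hJ := isCompact_drawing hσ.subset_edgeSet
  obtain ⟨a, ha, hb⟩ : ∃ a ∉ G.drawing σ,
      Bornology.IsBounded (connectedComponentIn (G.drawing σ)ᶜ a) := by
    obtain ⟨e, he⟩ : σ.Nonempty :=
      Set.nonempty_of_ncard_ne_zero (by have := hσ.three_le_ncard; omega)
    obtain ⟨z, hze, hz⟩ := exists_mem_arc_notMem_range_point (hσ.subset_edgeSet he)
    obtain ⟨x, -, y, -, hx, hy, hxy⟩ := exists_mem_ball_separated_by_cycle hσ he hze hz one_pos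
    by_contra! hall
    exact hxy (connectedComponentIn_compl_eq_of_not_isBounded hJ.isBounded (hall x hx) (hall y hy))
  refine ⟨a, ha, hb, fun e he z hze hz ε hε => ?_⟩
  obtain ⟨x, hx, y, hy, hxJ, hyJ, hxy⟩ := exists_mem_ball_separated_by_cycle hσ he hze hz hε
  rcases connectedComponentIn_compl_cycle_eq hσ hxJ hyJ ha with h | h | h
  · exact absurd h hxy
  · refine ⟨x, hx, y, hy, hxJ, hyJ, h ▸ mem_connectedComponentIn hxJ, fun hya => hxy ?_⟩
    rw [h, connectedComponentIn_eq hya]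
  · refine ⟨y, hy, x, hx, hyJ, hxJ, h ▸ mem_connectedComponentIn hyJ, fun hxa => hxy ?_⟩
    rw [h, connectedComponentIn_eq hxa]

/-- Every cycle is the boundary of a set of internal faces. -/
lemma IsTriangulated.exists_faceBoundary_eq [Finite V] (hG : G.IsTriangulated)
    (hσ : IsCycleEdgeSet G.graph σ) :
    ∃ S : Finset {F : Set ℂ // G.IsInternalFace F}, faceBoundary G.internalFaceEdges S = σ := by
  classical
  have := hG.finite_internalFaces
  have := Fintype.ofFinite {F : Set ℂ // G.IsInternalFace F}
  have hσG := hσ.subset_edgeSet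
  have hJ := isCompact_drawing hσG
  have hJS : G.supportᶜ ⊆ (G.drawing σ)ᶜ := Set.compl_subset_compl.2 (drawing_subset_support hσG)
  obtain ⟨a, ha, hb, hsep⟩ := exists_inside_of_cycle hσ
  set I := connectedComponentIn (G.drawing σ)ᶜ a with hI
  have hIo : IsOpen I := hJ.isClosed.isOpen_compl.connectedComponentIn
  have hface : ∀ x ∈ I, x ∉ G.support → connectedComponentIn G.supportᶜ x ⊆ I := by
    intro x hx hxS
    rw [hI, connectedComponentIn_eq hx]
    exact connectedComponentIn_mono x hJS
  have hint : ∀ x ∈ I, x ∉ G.support → G.IsInternalFace (connectedComponentIn G.supportᶜ x) :=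
    fun x hx hxS => ⟨isFace_connectedComponentIn hxS, hb.subset (hface x hx hxS)⟩
  -- Near an edge off the cycle either both faces lie in `I` or neither does; near an edge of the
  -- cycle exactly one does.
  refine ⟨Finset.univ.filter fun F => F.1 ⊆ I, ?_⟩
  ext e
  constructor
  · rintro ⟨F, hF, heF, hu⟩
    by_contra heσ
    have he : e ∈ G.graph.edgeSet := heF.1
    obtain ⟨z, hze, hz⟩ := exists_mem_arc_notMem_range_point he
    have hzF : z ∈ closure F.1 := arc_subset_closure_of_mem_faceEdges heF hze
    have hzJ : z ∉ G.drawing σ := fun h => heσ (mem_of_mem_arc_of_mem_drawing he hσG hze hz h)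
    have hzI : z ∈ I := (closure_connectedComponentIn_compl_subset hJ.isClosed a
      (closure_mono (Finset.mem_filter.1 hF).2 hzF)).resolve_right hzJ
    obtain ⟨ε₁, hε₁, hball⟩ := Metric.isOpen_iff.1 hIo z hzI
    obtain ⟨ε₂, hε₂, -, heq⟩ := exists_ball_face_eq he hze hz
    set ε := min ε₁ ε₂ with hε
    have hε0 : 0 < ε := lt_min hε₁ hε₂
    have hother : ∀ δ > 0, ∃ w ∈ Metric.ball z δ, w ∉ G.support ∧
        connectedComponentIn G.supportᶜ w ≠ F.1 := by
      intro δ hδ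
      obtain ⟨x, hx, y, hy, hxS, hyS, hxy⟩ :=
        exists_mem_ball_separated_by_support (hG.isCycleEdgeSet_faceEdges F.2) heF hze hz hδ
      by_cases hxF : connectedComponentIn G.supportᶜ x = F.1
      · exact ⟨y, hy, hyS, fun h => hxy (hxF.trans h.symm)⟩
      · exact ⟨x, hx, hxS, hxF⟩
    obtain ⟨w, hw, hwS, hwF⟩ := hother ε hε0
    obtain ⟨x, hx, hxz⟩ := exists_mem_ball_of_mem_closure hzF hε0
    have hwI : w ∈ I := hball (Metric.ball_subset_ball (min_le_left _ _) hw)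
    -- Only two faces come near `z`, so the points outside `F` found in ever smaller balls all
    -- belong to the face of `w`.
    have hzw : z ∈ closure (connectedComponentIn G.supportᶜ w) := by
      rw [Metric.mem_closure_iff]
      intro δ hδ
      obtain ⟨w', hw', hw'S, hw'F⟩ := hother (min δ ε) (lt_min hδ hε0)
      have h3 := heq w (Metric.ball_subset_ball (min_le_right _ _) hw) w'
        (Metric.ball_subset_ball ((min_le_right _ _).trans (min_le_right _ _)) hw') x
        (Metric.ball_subset_ball (min_le_right _ _) hxz) hwS hw'S (F.2.1.notMem_support hx)
      rw [← F.2.1.eq_connectedComponentIn hx] at h3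
      rcases h3 with h3 | h3 | h3
      · refine ⟨w', h3 ▸ mem_connectedComponentIn hw'S, ?_⟩
        rw [dist_comm]
        exact (Metric.mem_ball.1 hw').trans_le (min_le_left _ _)
      · exact absurd h3 hwF
      · exact absurd h3 hw'F
    have hwint := hint w hwI hwS
    exact hwF (congr_arg Subtype.val (hu ⟨_, hwint⟩
      (Finset.mem_filter.2 ⟨Finset.mem_univ _, hface w hwI hwS⟩)
      (hG.mem_faceEdges hwint he hze hz hzw)))
  · intro heσ
    have he := hσG heσ
    obtain ⟨z, hze, hz⟩ := exists_mem_arc_notMem_range_point he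
    obtain ⟨ε, hε, harc, heq⟩ := exists_ball_face_eq he hze hz
    have hnotS : ∀ x ∈ Metric.ball z ε, x ∉ G.drawing σ → x ∉ G.support := fun x hx hxJ hxS =>
      hxJ (Set.mem_iUnion₂.2 ⟨e, heσ, harc x hx hxS⟩)
    have hsep' : ∀ x ∈ I, ∀ y ∉ I, y ∉ G.support → x ∉ G.support →
        connectedComponentIn G.supportᶜ x ≠ connectedComponentIn G.supportᶜ y := by
      intro x hx y hy hyS hxS h
      exact hy (hface x hx hxS (h ▸ mem_connectedComponentIn hyS))
    obtain ⟨x, hx, y, hy, hxJ, hyJ, hxI, hyI⟩ := hsep e heσ z hze hz ε hε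
    have hxS := hnotS x hx hxJ
    have hyS := hnotS y hy hyJ
    have hxint := hint x hxI hxS
    have hzx : z ∈ closure (connectedComponentIn G.supportᶜ x) := by
      rw [Metric.mem_closure_iff]
      intro δ hδ
      obtain ⟨x', hx', -, -, hx'J, -, hx'I, -⟩ := hsep e heσ z hze hz (min δ ε) (lt_min hδ hε)
      have hx'ε := Metric.ball_subset_ball (min_le_right _ _) hx'
      have hx'S := hnotS x' hx'ε hx'J
      rcases heq x hx x' hx'ε y hy hxS hx'S hyS with h3 | h3 | h3
      · refine ⟨x', h3 ▸ mem_connectedComponentIn hx'S, ?_⟩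
        rw [dist_comm]
        exact (Metric.mem_ball.1 hx').trans_le (min_le_left _ _)
      · exact absurd h3 (hsep' x hxI y hyI hyS hxS)
      · exact absurd h3 (hsep' x' hx'I y hyI hyS hx'S)
    refine ⟨⟨_, hxint⟩, Finset.mem_filter.2 ⟨Finset.mem_univ _, hface x hxI hxS⟩,
      hG.mem_faceEdges hxint he hze hz hzx, fun F hF heF => Subtype.ext ?_⟩
    obtain ⟨w, hw, hwz⟩ :=
      exists_mem_ball_of_mem_closure (arc_subset_closure_of_mem_faceEdges heF hze) hε
    have hwS := F.2.1.notMem_support hw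
    have hwI : w ∈ I := (Finset.mem_filter.1 hF).2 hw
    rcases heq x hx w hwz y hy hxS hwS hyS with h3 | h3 | h3
    · exact (F.2.1.eq_connectedComponentIn hw).trans h3.symm
    · exact absurd h3 (hsep' x hxI y hyI hyS hxS)
    · exact absurd h3 (hsep' w hwI y hyI hyS hwS)

end Faces

end PlaneGraph

/-! ### Small even edge sets. -/

section EvenEdgeSets

variable {V : Type*} [Finite V] {H : SimpleGraph V}

lemma IsEvenEdgeSet.three_le_ncard {D : Set (Sym2 V)} (hD : IsEvenEdgeSet D)
    (hne : D.Nonempty) (hDH : D ⊆ H.edgeSet) : 3 ≤ D.ncard := by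
  obtain ⟨τ, hτD, hτ⟩ := hD.exists_cycle_subset hne hDH
  exact hτ.three_le_ncard.trans (Set.ncard_le_ncard hτD (Set.toFinite _))

/-- A small nonempty even set of edges is a cycle. -/
lemma IsEvenEdgeSet.isCycleEdgeSet_of_ncard_le {D : Set (Sym2 V)} (hD : IsEvenEdgeSet D)
    (hne : D.Nonempty) (hDH : D ⊆ H.edgeSet) (hcard : D.ncard ≤ 5) : IsCycleEdgeSet H D := by
  obtain ⟨τ, hτD, hτ⟩ := hD.exists_cycle_subset hne hDH
  have hdiff : D ∆ τ = D \ τ := by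
    rw [Set.symmDiff_def, Set.sdiff_eq_empty.2 hτD, Set.union_empty]
  have heven : IsEvenEdgeSet (D \ τ) := hdiff ▸ hD.symmDiff hτ.isEvenEdgeSet
  -- A nonempty remainder would be even and have at least three edges, as has `τ`: together at least
  -- six.
  rcases (D \ τ).eq_empty_or_nonempty with hemp | hne'
  · rwa [Set.Subset.antisymm (Set.sdiff_eq_empty.1 hemp) hτD]
  · have h1 := heven.three_le_ncard hne' (Set.sdiff_subset.trans hDH)
    have h2 := hτ.three_le_ncard
    have h3 := Set.ncard_sdiff_add_ncard_of_subset hτD (Set.toFinite _)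
    omega

end EvenEdgeSets

/-- The edge sets that are reached from sets in `C` as in the definition of cyclic spanning. -/
def CyclicallyReachable {V : Type*} (H : SimpleGraph V) (C : Set (Set (Sym2 V)))
    (σ : Set (Sym2 V)) : Prop :=
  ∃ (m : ℕ) (α : ℕ → Set (Sym2 V)), 1 ≤ m ∧ (∀ i, 1 ≤ i → i ≤ m → α i ∈ C) ∧
    σ = partialSymmDiff α m ∧ ∀ i, 2 ≤ i → i ≤ m → IsCycleEdgeSet H (partialSymmDiff α i)

/-! ### Sequences of cycles in the definition of cyclic spanning. -/

section Reachability

variable {V : Type*} {H : SimpleGraph V} {C : Set (Set (Sym2 V))}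

lemma cyclicallyReachable_of_mem {γ : Set (Sym2 V)} (hγ : γ ∈ C) : CyclicallyReachable H C γ := by
  refine ⟨1, fun _ => γ, le_rfl, fun _ _ _ => hγ, ?_, fun i h1 h2 => by omega⟩
  show γ = ∅ ∆ γ
  rw [← Set.bot_eq_empty, bot_symmDiff]

lemma partialSymmDiff_congr {α β : ℕ → Set (Sym2 V)} {m : ℕ} (h : ∀ i ≤ m, α i = β i) :
    partialSymmDiff α m = partialSymmDiff β m := by
  induction m with
  | zero => rfl
  | succ m ih =>
    rw [partialSymmDiff, partialSymmDiff, ih fun i hi => h i (hi.trans m.le_succ), h _ le_rfl]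

lemma CyclicallyReachable.symmDiff {σ γ : Set (Sym2 V)} (hσ : CyclicallyReachable H C σ)
    (hγ : γ ∈ C) (hcyc : IsCycleEdgeSet H (σ ∆ γ)) : CyclicallyReachable H C (σ ∆ γ) := by
  obtain ⟨m, α, hm, hα, rfl, hpart⟩ := hσ
  have heq : ∀ i ≤ m, partialSymmDiff (Function.update α (m + 1) γ) i = partialSymmDiff α i :=
    fun i hi => partialSymmDiff_congr fun j hj => Function.update_of_ne (by omega) _ _
  have hlast : partialSymmDiff (Function.update α (m + 1) γ) (m + 1) = partialSymmDiff α m ∆ γ := by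
    rw [partialSymmDiff, heq m le_rfl, Function.update_self]
  refine ⟨m + 1, Function.update α (m + 1) γ, by omega, fun i h1 h2 => ?_, hlast.symm,
    fun i h1 h2 => ?_⟩
  · rcases Nat.lt_or_ge m i with h | h
    · obtain rfl : i = m + 1 := by omega
      rwa [Function.update_self]
    · rw [Function.update_of_ne (by omega)]
      exact hα i h1 h
  · rcases Nat.lt_or_ge m i with h | h
    · obtain rfl : i = m + 1 := by omega
      rwa [hlast]
    · rw [heq i h]
      exact hpart i h1 h

end Reachability

/-! ### Cycles as boundaries of bonds, and the construction of cycles face by face. -/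

namespace PlaneGraph

variable {V : Type*} [Finite V] {G : PlaneGraph V}

lemma IsTriangulated.isEvenEdgeSet_faceBoundary (hG : G.IsTriangulated)
    (S : Finset {F : Set ℂ // G.IsInternalFace F}) :
    IsEvenEdgeSet (faceBoundary G.internalFaceEdges S) := by
  classical
  induction S using Finset.induction_on with
  | empty => exact faceBoundary_empty G.internalFaceEdges ▸ isEvenEdgeSet_empty
  | insert F S hF ih =>
    rw [faceBoundary_eq_symmDiff_erase atMostTwoFaces_internalFaceEdges
      (Finset.mem_insert_self F S), Finset.erase_insert hF]
    exact ih.symmDiff (hG.isCycleEdgeSet_faceEdges F.2).isEvenEdgeSet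

/-- The set `R ∆ S` has an edge on exactly one of its faces if it is nonempty. At this edge the
boundaries of `R` and `S` differ. -/
lemma IsTriangulated.faceBoundary_injective (hG : G.IsTriangulated) :
    Function.Injective (faceBoundary G.internalFaceEdges) := by
  classical
  have key : ∀ (R S : Finset {F : Set ℂ // G.IsInternalFace F}) (e : Sym2 V)
      (F : {F : Set ℂ // G.IsInternalFace F}), F ∈ R → F ∉ S → e ∈ G.internalFaceEdges F →
      (∀ F' ∈ R ∆ S, e ∈ G.internalFaceEdges F' → F' = F) →
      faceBoundary G.internalFaceEdges R ≠ faceBoundary G.internalFaceEdges S := by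
    intro R S e F hFR hFS heF hu h
    by_cases heR : e ∈ faceBoundary G.internalFaceEdges R
    · obtain ⟨F', hF', heF', -⟩ : e ∈ faceBoundary G.internalFaceEdges S := h ▸ heR
      obtain ⟨E, hE, heE, huE⟩ := heR
      have hF'R : F' ∉ R := by
        intro hF'R
        exact hFS ((huE F hFR heF).trans (huE F' hF'R heF').symm ▸ hF')
      exact hFS (hu F' (Finset.mem_symmDiff.2 (Or.inr ⟨hF', hF'R⟩)) heF' ▸ hF')
    · obtain ⟨F', hF'R, heF', hne⟩ := exists_other_face_of_notMem_faceBoundary hFR heF heR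
      have hF'S : F' ∈ S := by
        by_contra hF'S
        exact hne (hu F' (Finset.mem_symmDiff.2 (Or.inl ⟨hF'R, hF'S⟩)) heF')
      refine heR (h ▸ ⟨F', hF'S, heF', fun E hE heE => ?_⟩)
      rcases atMostTwoFaces_internalFaceEdges e F F' E heF heF' heE with h | h | h
      · exact absurd h.symm hne
      · exact absurd (h ▸ hE) hFS
      · exact h.symm
  intro R S h
  by_contra hne
  have hne' : (R ∆ S).Nonempty := by
    rw [Finset.nonempty_iff_ne_empty, ← Finset.bot_eq_empty]
    exact fun h => hne (symmDiff_eq_bot.1 h)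
  obtain ⟨e, F, hF, heF, hu⟩ := hG.faceBoundary_nonempty hne'
  rcases Finset.mem_symmDiff.1 hF with ⟨h1, h2⟩ | ⟨h1, h2⟩
  · exact key R S e F h1 h2 heF hu h
  · exact key S R e F h1 h2 heF (symmDiff_comm R S ▸ hu) h.symm

/-- The boundary of a bond of internal faces is a cycle. -/
lemma IsTriangulated.isCycleEdgeSet_of_isFaceBond (hG : G.IsTriangulated)
    {S : Finset {F : Set ℂ // G.IsInternalFace F}} (hS : IsFaceBond G.internalFaceEdges S) :
    IsCycleEdgeSet G.graph (faceBoundary G.internalFaceEdges S) := by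
  -- The even boundary contains a cycle, which is itself the boundary of some set of faces;
  -- minimality forces this set to be `S`.
  obtain ⟨τ, hτS, hτ⟩ := (hG.isEvenEdgeSet_faceBoundary S).exists_cycle_subset
    (hG.faceBoundary_nonempty hS.1) (faceBoundary_subset_edgeSet S)
  obtain ⟨R, rfl⟩ := hG.exists_faceBoundary_eq hτ
  rcases hS.2 R hτS with rfl | rfl
  · have := hτ.three_le_ncard
    rw [faceBoundary_empty, Set.ncard_empty] at this
    omega
  · exact hτ

/-- Every cycle is the boundary of a bond of internal faces. -/
lemma IsTriangulated.exists_isFaceBond (hG : G.IsTriangulated) {σ : Set (Sym2 V)}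
    (hσ : IsCycleEdgeSet G.graph σ) :
    ∃ S, IsFaceBond G.internalFaceEdges S ∧ faceBoundary G.internalFaceEdges S = σ := by
  obtain ⟨S, rfl⟩ := hG.exists_faceBoundary_eq hσ
  refine ⟨S, ⟨?_, fun R hR => ?_⟩, rfl⟩
  · rw [Finset.nonempty_iff_ne_empty]
    rintro rfl
    have := hσ.three_le_ncard
    rw [faceBoundary_empty, Set.ncard_empty] at this
    omega
  · rcases R.eq_empty_or_nonempty with h | h
    · exact Or.inl h
    -- A cycle is minimal among nonempty even sets, so the two boundaries are equal, and by
    -- injectivity so are the sets of faces.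
    · exact Or.inr (hG.faceBoundary_injective (hσ.eq_of_isEvenEdgeSet_subset
        (hG.isEvenEdgeSet_faceBoundary R) (hG.faceBoundary_nonempty h) hR))

/-- Two triangles with a common edge leave at most `3 + 3 - 2 = 4` edges, too few for an even set
that is not a single cycle. -/
lemma IsTriangulated.isCycleEdgeSet_symmDiff (hG : G.IsTriangulated) {A B : Set ℂ}
    (hA : G.IsInternalFace A) (hB : G.IsInternalFace B) (hAB : A ≠ B)
    (hcommon : (G.faceEdges A ∩ G.faceEdges B).Nonempty) :
    IsCycleEdgeSet G.graph (G.faceEdges A ∆ G.faceEdges B) := by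
  have hA' := hG.isCycleEdgeSet_faceEdges hA
  have hB' := hG.isCycleEdgeSet_faceEdges hB
  refine (hA'.isEvenEdgeSet.symmDiff hB'.isEvenEdgeSet).isCycleEdgeSet_of_ncard_le ?_ ?_ ?_
  · rw [Set.nonempty_iff_ne_empty, ← Set.bot_eq_empty]
    intro h
    have h' : (⟨A, hA⟩ : {F : Set ℂ // G.IsInternalFace F}) = ⟨B, hB⟩ :=
      hG.injective_internalFaceEdges (symmDiff_eq_bot.1 h)
    exact hAB (congr_arg Subtype.val h')
  · rintro e (he | he)
    · exact he.1.1
    · exact he.1.1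
  · have h1 := ncard_symmDiff_add (G.faceEdges A) (G.faceEdges B)
    have h2 := (Set.ncard_pos (Set.toFinite _)).2 hcommon
    rw [hG.ncard_faceEdges hA, hG.ncard_faceEdges hB] at h1
    omega

/-- The boundary of a bond is reached by adding its faces in a suitable order, starting with the
face `A` if it belongs to the bond. -/
lemma IsTriangulated.cyclicallyReachable_of_isFaceBond (hG : G.IsTriangulated)
    {C : Set (Set (Sym2 V))} (A : {F : Set ℂ // G.IsInternalFace F})
    (hA : CyclicallyReachable G.graph C (G.faceEdges A.1))
    (hC : ∀ F : {F : Set ℂ // G.IsInternalFace F}, F ≠ A → G.faceEdges F.1 ∈ C) (n : ℕ) :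
    ∀ S : Finset {F : Set ℂ // G.IsInternalFace F}, S.card = n + 1 →
      IsFaceBond G.internalFaceEdges S →
      CyclicallyReachable G.graph C (faceBoundary G.internalFaceEdges S) := by
  classical
  induction n with
  | zero =>
    intro S hcard _
    obtain ⟨F, rfl⟩ := Finset.card_eq_one.1 hcard
    rw [faceBoundary_singleton]
    by_cases hF : F = A
    · exact hF ▸ hA
    · exact cyclicallyReachable_of_mem (hC F hF)
  | succ n ih =>
    intro S hcard hS
    -- The protected face is `A` if it belongs to `S`; otherwise any face will do, since `A` cannot
    -- then be removed.
    obtain ⟨A', hA'S, hA'⟩ : ∃ A' ∈ S, A ∈ S → A' = A := by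
      by_cases h : A ∈ S
      · exact ⟨A, h, fun _ => rfl⟩
      · obtain ⟨F, hF⟩ := hS.1
        exact ⟨F, hF, fun h' => absurd h' h⟩
    obtain ⟨T, hTS, hTA, hT⟩ := hS.exists_erase atMostTwoFaces_internalFaceEdges
      (fun F => hG.ncard_faceEdges F.2)
      (fun S hS => (hG.isEvenEdgeSet_faceBoundary S).three_le_ncard
        (hG.faceBoundary_nonempty hS) (faceBoundary_subset_edgeSet S)) hA'S (by omega)
    have hTA' : T ≠ A := by
      rintro rfl
      exact hTA (hA' hTS).symm
    have heq := faceBoundary_eq_symmDiff_erase atMostTwoFaces_internalFaceEdges hTS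
    have hcyc := hG.isCycleEdgeSet_of_isFaceBond hS
    rw [heq] at hcyc ⊢
    exact (ih _ (by rw [Finset.card_erase_of_mem hTS]; omega) hT).symmDiff (hC T hTA') hcyc

end PlaneGraph

theorem mainTheorem2 {V : Type*} [Finite V] (G : PlaneGraph V) (hG : G.IsTriangulated)
    (A B : Set ℂ) (hA : G.IsInternalFace A) (hB : G.IsInternalFace B) (hAB : A ≠ B)
    (hcommon : (G.faceEdges A ∩ G.faceEdges B).Nonempty) :
    CyclicallySpans G.graph
      (insert (G.faceEdges A ∆ G.faceEdges B) (G.internalFaceCycles \ {G.faceEdges A})) := by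
  have hAcyc := hG.isCycleEdgeSet_faceEdges hA
  have hmem : ∀ F : {F : Set ℂ // G.IsInternalFace F}, F ≠ ⟨A, hA⟩ → G.faceEdges F.1 ∈
      insert (G.faceEdges A ∆ G.faceEdges B) (G.internalFaceCycles \ {G.faceEdges A}) :=
    fun F hF => Or.inr ⟨⟨F.1, F.2, rfl⟩, fun h => hF (hG.injective_internalFaceEdges h)⟩
  have hreach : CyclicallyReachable G.graph
      (insert (G.faceEdges A ∆ G.faceEdges B) (G.internalFaceCycles \ {G.faceEdges A}))
      (G.faceEdges A) := by
    -- The deleted face is recovered as `(A ∆ B) ∆ B`, where `B` is still available because it is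
    -- different from `A`.
    have h := (cyclicallyReachable_of_mem (H := G.graph) (Set.mem_insert _ _)).symmDiff
      (hmem ⟨B, hB⟩ fun h => hAB (congr_arg Subtype.val h).symm)
      (by rwa [symmDiff_symmDiff_cancel_right])
    rwa [symmDiff_symmDiff_cancel_right] at h
  refine ⟨?_, fun σ hσ => ?_⟩
  · rintro γ (rfl | ⟨⟨F, hF, rfl⟩, -⟩)
    · exact hG.isCycleEdgeSet_symmDiff hA hB hAB hcommon
    · exact hG.isCycleEdgeSet_faceEdges hF
  · obtain ⟨S, hS, rfl⟩ := hG.exists_isFaceBond hσ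
    have hpos := hS.1.card_pos
    exact hG.cyclicallyReachable_of_isFaceBond ⟨A, hA⟩ hreach hmem (S.card - 1) S (by omega) hS
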